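/- Let $H$ be a separable infinite-dimensional Hilbert space with compact operators $\mathcal K(H)$ and Calkin algebra $\mathcal Q(H)=\mathcal B(H)/\mathcal K(H)$, $\pi:\mathcal B(H)\to\mathcal Q(H)$ the quotient map, and let $A,A'$ be separable unital nuclear $C^*$-algebras. An extension of $A$ is a short exact sequence $\tau: 0\to\mathcal K(H)\xrightarrow{\iota}E\xrightarrow{q}A\to0$ with $E$ a unital $C^*$-algebra containing $\mathcal K(H)$ as an essential ideal; it is identified with its Busby invariant $\tau:A\to\mathcal Q(H)$. Two extensions $\tau_1,\tau_2$ of $A$ are strongly equivalent ($[\tau_1]_s=[\tau_2]_s$ in $\mathrm{Ext}_s(A)$) if $\tau_2(a)=\pi(U)\tau_1(a)\pi(U)^*$ for all $a\in A$, for some unitary $U\in\mathcal B(H)$. Fix an ample (unital) representation $\rho:A\to\mathcal B(H)$, put $\mathfrak D(A)=\{T\in\mathcal B(H): [T,\rho(a)]\in\mathcal K(H)\ \forall a\in A\}$, and form $\mathfrak D(\widetilde A)$ in the same way from the representation $(a,c)\mapsto(\rho(a)+c)\oplus c$ of the unitization $\widetilde A$ on $H\oplus H$; likewise for $A'$ (with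 any ample representation $\rho'$ on $H$) and for $\mathbb C$ (acting on $H$ by scalars). Let $\widetilde K^p(A)=K_{1-p}(\mathfrak D(A))$ and $K^p(A)=K_{1-p}(\mathfrak D(\widetilde A))$, $p=0,1$. Let $j_A^p:\widetilde K^p(A)\to K^p(A)$ be induced by the upper left corner embedding, $\iota_{\mathbb C}^*:K^0(A)\to K^0(\mathbb C)$ by the unital inclusion $\mathbb C\to A$, and, under $\widetilde K^1(A)=\mathrm{Ext}_s(A)$ and $K^0(\mathbb C)=K_1(\mathcal Q(H))$, let $\iota_A:K^0(\mathbb C)\to\widetilde K^1(A)$ send the class of a unitary $u\in\mathcal Q(H)$ to the class of the extension $\mathrm{Ad}(u)\circ\pi\circ\rho$. Here a projection $VV^*\in\mathfrak D(A)$, $V$ an isometry on $H$, represents the class of the extension $a\mapsto\pi(V^*\rho(a)V)$. Extensions $\tau$ of $A$ (with algebra $E$) and $\tau'$ of $A'$ (with algebra $E'$) are a K-theoretic duality pair if there are group isomorphisms $$\widetilde\Phi^0:\widetilde K^0(A)\to K_1(E'),\quad \Phi^0:K^0(A)\to K_1(A'),\quad \Phi^0_{\mathbb C}:K^0(\mathbb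 C)\to K_0(\mathcal K(H)),\quad \widetilde\Phi^1:\widetilde K^1(A)\to K_0(E'),\quad \Phi^1:K^1(A)\to K_0(A')$$ with $q'_*\widetilde\Phi^0=\Phi^0 j^0_A$, $\partial\,\Phi^0=\Phi^0_{\mathbb C}\,\iota_{\mathbb C}^*$, $\iota'_*\Phi^0_{\mathbb C}=\widetilde\Phi^1\iota_A$, $q'_*\widetilde\Phi^1=\Phi^1j^1_A$ (where $\partial:K_1(A')\to K_0(\mathcal K(H))$ is the index map of $\tau'$), and also isomorphisms $\widetilde\Phi'^0,\Phi'^0,\Phi'^0_{\mathbb C},\widetilde\Phi'^1,\Phi'^1$ with the same properties after exchanging the roles of $(A,\tau)$ and $(A',\tau')$. They are a strong K-theoretic duality pair if the isomorphisms can be chosen such that moreover $\Phi^0_{\mathbb C}=\Phi'^0_{\mathbb C}=\mathrm{id}$ under the identifications $K^0(\mathbb C)=\mathbb Z$ (Fredholm index) and $K_0(\mathcal K(H))=\mathbb Z$ (class of a rank one projection $\mapsto1$), and $\widetilde\Phi^1([\tau]_s)=-[1_{E'}]$ in $K_0(E')$, $\widetilde\Phi'^1([\tau']_s)=-[1_E]$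 in $K_0(E)$. Proposition. Let $\tau_1,\tau_2$ be extensions of $A$ and $\tau_1',\tau_2'$ extensions of $A'$ such that $[\tau_1]_s=[\tau_2]_s$ in $\mathrm{Ext}_s(A)$ and $[\tau_1']_s=[\tau_2']_s$ in $\mathrm{Ext}_s(A')$. Then $\tau_1$ and $\tau_1'$ are a K-theoretic duality pair if and only if $\tau_2$ and $\tau_2'$ are, and $\tau_1$ and $\tau_1'$ are a strong K-theoretic duality pair if and only if $\tau_2$ and $\tau_2'$ are. -/

import Mathlib

namespace KDuality

noncomputable section

open Matrix

/-! ## Topological K-theory of unital C*-algebras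

`K0` and `K1` are given by generators (projections, resp. unitaries, in all matrix algebras) and
relations. -/

section Matrices

variable {R S : Type*} [Ring R] [Ring S]

/-- The block diagonal sum `x ⊕ y` in `M_{m+n}(R)`. -/
def dsum {m n : ℕ} (x : Matrix (Fin m) (Fin m) R) (y : Matrix (Fin n) (Fin n) R) :
    Matrix (Fin (m + n)) (Fin (m + n)) R :=
  (fromBlocks x 0 0 y).submatrix finSumFinEquiv.symm finSumFinEquiv.symm

theorem dsum_mul {m n : ℕ} (x x' : Matrix (Fin m) (Fin m) R) (y y' : Matrix (Fin n) (Fin n) R) :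
    dsum x y * dsum x' y' = dsum (x * x') (y * y') := by
  simp [dsum, fromBlocks_multiply]

theorem dsum_one {m n : ℕ} :
    dsum (1 : Matrix (Fin m) (Fin m) R) (1 : Matrix (Fin n) (Fin n) R) = 1 := by
  simp [dsum]

theorem dsum_add {m n : ℕ} (x x' : Matrix (Fin m) (Fin m) R) (y y' : Matrix (Fin n) (Fin n) R) :
    dsum x y + dsum x' y' = dsum (x + x') (y + y') := by
  have h : fromBlocks x 0 0 y + fromBlocks x' 0 0 y' = fromBlocks (x + x') 0 0 (y + y') := by
    ext (i | i) (j | j) <;> simp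
  rw [dsum, dsum, dsum, ← h]; rfl

theorem dsum_sub {m n : ℕ} (x x' : Matrix (Fin m) (Fin m) R) (y y' : Matrix (Fin n) (Fin n) R) :
    dsum x y - dsum x' y' = dsum (x - x') (y - y') := by
  have h : fromBlocks x 0 0 y - fromBlocks x' 0 0 y' = fromBlocks (x - x') 0 0 (y - y') := by
    ext (i | i) (j | j) <;> simp
  rw [dsum, dsum, dsum, ← h]; rfl

theorem star_dsum [StarRing R] {m n : ℕ} (x : Matrix (Fin m) (Fin m) R)
    (y : Matrix (Fin n) (Fin n) R) : star (dsum x y) = dsum (star x) (star y) := by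
  simp [dsum, star_eq_conjTranspose, conjTranspose_submatrix, fromBlocks_conjTranspose]

theorem map_dsum {m n : ℕ} (x : Matrix (Fin m) (Fin m) R) (y : Matrix (Fin n) (Fin n) R)
    (f : R → S) (hf : f 0 = 0) : (dsum x y).map f = dsum (x.map f) (y.map f) := by
  simp [dsum, ← submatrix_map, fromBlocks_map, hf]

theorem map_unitary_mem {R S : Type*} [Ring R] [StarRing R] [Ring S] [StarRing S] [Algebra ℂ R]
    [Algebra ℂ S] (φ : R →⋆ₙₐ[ℂ] S) {n : ℕ} (u : unitary (Matrix (Fin n) (Fin n) R)) :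
    (u : Matrix _ _ R).map φ + (1 - (1 : Matrix (Fin n) (Fin n) R).map φ) ∈
      unitary (Matrix (Fin n) (Fin n) S) := by
  have hs : ∀ x : Matrix (Fin n) (Fin n) R, star (x.map φ) = (star x).map φ := fun x => by
    rw [star_eq_conjTranspose, star_eq_conjTranspose, conjTranspose_map φ (fun x => map_star φ x)]
  have hm : ∀ x y : Matrix (Fin n) (Fin n) R, x.map φ * y.map φ = (x * y).map φ := fun x y => by
    rw [Matrix.map_mul]
  rw [Unitary.mem_iff]
  have h1 : star (u : Matrix (Fin n) (Fin n) R) * (u : Matrix (Fin n) (Fin n) R) = 1 :=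
    Unitary.star_mul_self_of_mem u.2
  have h2 : (u : Matrix (Fin n) (Fin n) R) * star (u : Matrix (Fin n) (Fin n) R) = 1 :=
    Unitary.mul_star_self_of_mem u.2
  constructor <;>
    simp only [star_add, star_sub, star_one, hs, add_mul, mul_add, sub_mul, mul_sub, hm, one_mul,
      mul_one, h1, h2] <;> abel

theorem map_dsum_add {R S : Type*} [Ring R] [StarRing R] [Ring S] [StarRing S] [Algebra ℂ R]
    [Algebra ℂ S] (φ : R →⋆ₙₐ[ℂ] S) {m n : ℕ} (x : Matrix (Fin m) (Fin m) R)
    (y : Matrix (Fin n) (Fin n) R) :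
    (dsum x y).map φ + (1 - (1 : Matrix (Fin (m + n)) (Fin (m + n)) R).map φ) =
      dsum (x.map φ + (1 - (1 : Matrix (Fin m) (Fin m) R).map φ))
        (y.map φ + (1 - (1 : Matrix (Fin n) (Fin n) R).map φ)) := by
  rw [map_dsum _ _ _ (map_zero φ), ← dsum_one (R := R), ← dsum_one (R := S),
    map_dsum _ _ _ (map_zero φ), dsum_sub, dsum_add]

end Matrices

section K0

variable (R : Type*) [Ring R] [StarRing R]

/-- Projections in the matrix algebras over `R`. -/
structure Proj where
  size : ℕ
  mat : Matrix (Fin size) (Fin size) R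
  isProj : IsStarProjection mat

variable {R}

/-- Block sum of projections. -/
def Proj.sum (p q : Proj R) : Proj R where
  size := p.size + q.size
  mat := dsum p.mat q.mat
  isProj := by
    refine ⟨?_, ?_⟩
    · rw [IsIdempotentElem, dsum_mul, p.isProj.isIdempotentElem.eq, q.isProj.isIdempotentElem.eq]
    · rw [IsSelfAdjoint, star_dsum, p.isProj.isSelfAdjoint.star_eq, q.isProj.isSelfAdjoint.star_eq]

/-- Murray--von Neumann equivalence of projections in matrix algebras (of possibly different
sizes): `v* v = p` and `v v* = q`. -/
def Proj.MvN (p q : Proj R) : Prop :=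
  ∃ v : Matrix (Fin q.size) (Fin p.size) R, vᴴ * v = p.mat ∧ v * vᴴ = q.mat

variable (R)

/-- The relations `[p] = [q]` for `p ∼ q`, and `[p ⊕ q] = [p] + [q]`. -/
def K0Rel : Set (FreeAbelianGroup (Proj R)) :=
  {x | ∃ p q : Proj R, p.MvN q ∧ x = .of p - .of q} ∪
  {x | ∃ p q : Proj R, x = .of (p.sum q) - (.of p + .of q)}

/-- `K₀(R)`: the Grothendieck group of Murray--von Neumann classes of projections over `R`. -/
def K0 : Type _ := FreeAbelianGroup (Proj R) ⧸ AddSubgroup.closure (K0Rel R)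

instance : AddCommGroup (K0 R) :=
  inferInstanceAs (AddCommGroup (FreeAbelianGroup (Proj R) ⧸ AddSubgroup.closure (K0Rel R)))

variable {R}

/-- The class `[p]` of a projection in a matrix algebra. -/
def K0.mk (p : Proj R) : K0 R := QuotientAddGroup.mk (FreeAbelianGroup.of p)

/-- The class of a projection of `R` itself. -/
def K0.ofElem (p : R) (hp : IsStarProjection p) : K0 R :=
  K0.mk
    { size := 1
      mat := Matrix.diagonal fun _ => p
      isProj := by
        refine ⟨?_, ?_⟩
        · rw [IsIdempotentElem, diagonal_mul_diagonal]
          simp [hp.isIdempotentElem.eq]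
        · rw [IsSelfAdjoint, star_eq_conjTranspose, diagonal_conjTranspose]
          congr 1
          funext _
          exact hp.isSelfAdjoint.star_eq }

variable (R) in
/-- The class `[1_R]` of the unit. -/
def K0.one : K0 R := K0.ofElem (1 : R) (IsStarProjection.one R)

variable {S : Type*} [Ring S] [StarRing S] [Algebra ℂ R] [Algebra ℂ S]

/-- Entrywise application of a *-homomorphism to a projection. -/
def Proj.map (φ : R →⋆ₙₐ[ℂ] S) (p : Proj R) : Proj S where
  size := p.size
  mat := p.mat.map φ
  isProj := by
    refine ⟨?_, ?_⟩
    · rw [IsIdempotentElem, ← Matrix.map_mul, p.isProj.isIdempotentElem.eq]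
    · rw [IsSelfAdjoint, star_eq_conjTranspose, ← conjTranspose_map φ (fun x => map_star φ x),
        ← star_eq_conjTranspose, p.isProj.isSelfAdjoint.star_eq]

/-- The homomorphism `φ_* : K₀(R) → K₀(S)`, `[p] ↦ [φ(p)]`, induced by a (not necessarily unital)
*-homomorphism. -/
def K0.map (φ : R →⋆ₙₐ[ℂ] S) : K0 R →+ K0 S :=
  QuotientAddGroup.lift _ (FreeAbelianGroup.lift fun p => K0.mk (p.map φ)) (by
    rw [AddSubgroup.closure_le]
    rintro x (⟨p, q, ⟨v, hv, hv'⟩, rfl⟩ | ⟨p, q, rfl⟩)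
    · simp only [SetLike.mem_coe, AddMonoidHom.mem_ker, map_sub, FreeAbelianGroup.lift_apply_of]
      refine (QuotientAddGroup.eq_zero_iff _).2 (AddSubgroup.subset_closure (Or.inl
        ⟨p.map φ, q.map φ, ⟨v.map φ, ?_, ?_⟩, rfl⟩))
      · change (v.map φ)ᴴ * v.map φ = p.mat.map φ
        rw [← conjTranspose_map φ (fun x => map_star φ x), ← Matrix.map_mul, hv]
      · change v.map φ * (v.map φ)ᴴ = q.mat.map φ
        rw [← conjTranspose_map φ (fun x => map_star φ x), ← Matrix.map_mul, hv']
    · simp only [SetLike.mem_coe, AddMonoidHom.mem_ker, map_sub, map_add,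
        FreeAbelianGroup.lift_apply_of]
      have h : (p.sum q).map φ = (p.map φ).sum (q.map φ) := by
        simp only [Proj.map, Proj.sum]
        congr 1
        exact map_dsum _ _ _ (map_zero φ)
      rw [h]
      exact (QuotientAddGroup.eq_zero_iff _).2 (AddSubgroup.subset_closure (Or.inr
        ⟨p.map φ, q.map φ, rfl⟩)))

end K0

section K1

variable (R : Type*) [Ring R] [StarRing R]

/-- Unitaries in the matrix algebras over `R`. -/
structure UnitaryMat where
  size : ℕ
  mat : unitary (Matrix (Fin size) (Fin size) R)

variable {R}

/-- Block sum of unitaries. -/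
def UnitaryMat.sum (u v : UnitaryMat R) : UnitaryMat R where
  size := u.size + v.size
  mat := ⟨dsum (u.mat : Matrix _ _ R) (v.mat : Matrix _ _ R), by
    rw [Unitary.mem_iff, star_dsum, dsum_mul, dsum_mul]
    simp [dsum_one]⟩

variable (R) [TopologicalSpace R]

/-- The relations `[u] = [v]` for `u, v` joined by a path of unitaries of the same size,
`[1_n] = 0`, and `[u ⊕ v] = [u] + [v]`. -/
def K1Rel : Set (FreeAbelianGroup (UnitaryMat R)) :=
  {x | ∃ (n : ℕ) (u v : unitary (Matrix (Fin n) (Fin n) R)), Joined u v ∧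
    x = .of ⟨n, u⟩ - .of ⟨n, v⟩} ∪
  {x | ∃ n : ℕ, x = .of ⟨n, 1⟩} ∪
  {x | ∃ u v : UnitaryMat R, x = .of (u.sum v) - (.of u + .of v)}

/-- `K₁(R)`: stable homotopy classes of unitaries over `R`. -/
def K1 : Type _ := FreeAbelianGroup (UnitaryMat R) ⧸ AddSubgroup.closure (K1Rel R)

instance : AddCommGroup (K1 R) :=
  inferInstanceAs (AddCommGroup (FreeAbelianGroup (UnitaryMat R) ⧸ AddSubgroup.closure (K1Rel R)))

variable {R}

/-- The class `[u]` of a unitary in `M_n(R)`. -/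
def K1.mk {n : ℕ} (u : unitary (Matrix (Fin n) (Fin n) R)) : K1 R :=
  QuotientAddGroup.mk (FreeAbelianGroup.of ⟨n, u⟩)

variable {S : Type*} [Ring S] [StarRing S] [Algebra ℂ R] [Algebra ℂ S]

/-- The unitary `φ(u) + (1 - φ(1))`; this is `φ(u)` for unital `φ`. -/
def UnitaryMat.mapMat (φ : R →⋆ₙₐ[ℂ] S) {n : ℕ} (u : unitary (Matrix (Fin n) (Fin n) R)) :
    unitary (Matrix (Fin n) (Fin n) S) :=
  ⟨(u : Matrix (Fin n) (Fin n) R).map φ + (1 - (1 : Matrix (Fin n) (Fin n) R).map φ), map_unitary_mem φ u⟩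

variable [TopologicalSpace S] [IsTopologicalRing S]

/-- The homomorphism `φ_* : K₁(R) → K₁(S)` induced by a continuous (not necessarily unital)
*-homomorphism, `[u] ↦ [φ(u) + 1 - φ(1)]`. -/
def K1.map (φ : R →⋆ₙₐ[ℂ] S) (hφ : Continuous φ) : K1 R →+ K1 S :=
  QuotientAddGroup.lift _ (FreeAbelianGroup.lift fun u => K1.mk (UnitaryMat.mapMat φ u.mat)) (by
    rw [AddSubgroup.closure_le]
    rintro x ((⟨n, u, v, h, rfl⟩ | ⟨n, rfl⟩) | ⟨u, v, rfl⟩)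
    · simp only [SetLike.mem_coe, AddMonoidHom.mem_ker, map_sub, FreeAbelianGroup.lift_apply_of]
      refine (QuotientAddGroup.eq_zero_iff _).2 (AddSubgroup.subset_closure (Or.inl (Or.inl
        ⟨n, UnitaryMat.mapMat φ u, UnitaryMat.mapMat φ v, ?_, rfl⟩)))
      have hc : Continuous (fun w : unitary (Matrix (Fin n) (Fin n) R) => UnitaryMat.mapMat φ w) :=
        Continuous.subtype_mk ((continuous_subtype_val.matrix_map hφ).add continuous_const) _
      exact h.map hc
    · simp only [SetLike.mem_coe, AddMonoidHom.mem_ker, FreeAbelianGroup.lift_apply_of]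
      have h : UnitaryMat.mapMat φ (1 : unitary (Matrix (Fin n) (Fin n) R)) = 1 :=
        Subtype.ext (by simp [UnitaryMat.mapMat])
      rw [h]
      exact (QuotientAddGroup.eq_zero_iff _).2 (AddSubgroup.subset_closure (Or.inl (Or.inr
        ⟨n, rfl⟩)))
    · simp only [SetLike.mem_coe, AddMonoidHom.mem_ker, map_sub, map_add,
        FreeAbelianGroup.lift_apply_of]
      have h : UnitaryMat.mapMat φ (u.sum v).mat =
          (UnitaryMat.sum ⟨u.size, UnitaryMat.mapMat φ u.mat⟩ ⟨v.size, UnitaryMat.mapMat φ v.mat⟩).mat := by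
        apply Subtype.ext
        exact map_dsum_add φ _ _
      rw [h]
      exact (QuotientAddGroup.eq_zero_iff _).2 (AddSubgroup.subset_closure (Or.inr
        ⟨_, _, rfl⟩)))

end K1

section K0NonUnital

variable (I : Type*) [NonUnitalRing I] [StarRing I] [Module ℂ I] [IsScalarTower ℂ I I]
  [SMulCommClass ℂ I I] [StarModule ℂ I]

/-- The scalar part `I⁺ → ℂ` on the unitization. -/
def scalarPart : Unitization ℂ I →⋆ₐ[ℂ] ℂ :=
  { Unitization.fstHom ℂ I with map_star' := fun x => Unitization.fst_star x }

/-- `K₀(I)` of a non-unital algebra: the kernel of `K₀(I⁺) → K₀(ℂ)`. -/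
def K0NonUnital : AddSubgroup (K0 (Unitization ℂ I)) :=
  (K0.map (scalarPart I).toNonUnitalStarAlgHom).ker

variable {I} {R : Type*} [Ring R] [StarRing R] [Algebra ℂ R] [StarModule ℂ R]

/-- The homomorphism `K₀(I) → K₀(R)` induced by a *-homomorphism into a unital algebra. -/
def K0NonUnital.map (φ : I →⋆ₙₐ[ℂ] R) : K0NonUnital I →+ K0 R :=
  (K0.map (Unitization.starLift φ).toNonUnitalStarAlgHom).comp (K0NonUnital I).subtype

end K0NonUnital

/-! ## Compact operators and the Calkin algebra -/

set_option linter.unusedSectionVars false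

section Hilbert

variable {H : Type*} [NormedAddCommGroup H] [InnerProductSpace ℂ H] [CompleteSpace H]

theorem isCompactOperator_star {T : H →L[ℂ] H} (hT : IsCompactOperator T) :
    IsCompactOperator (star T : H →L[ℂ] H) := by
  have hS : IsCompactOperator (T * star T) := hT.comp_clm (star T)
  have hS' : IsCompact (closure ((T * star T) '' Metric.closedBall 0 1)) :=
    (isCompactOperator_iff_isCompact_closure_image_closedBall
      ((T * star T : H →L[ℂ] H) : H →ₗ[ℂ] H) zero_lt_one).1 hS
  have htb : TotallyBounded ((T * star T) '' Metric.closedBall 0 1) :=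
    hS'.totallyBounded.subset subset_closure
  refine (isCompactOperator_iff_isCompact_closure_image_closedBall
    ((star T : H →L[ℂ] H) : H →ₗ[ℂ] H) zero_lt_one).2 ?_
  refine TotallyBounded.isCompact_of_isClosed (TotallyBounded.closure ?_) isClosed_closure
  rw [Metric.totallyBounded_iff]
  intro ε hε
  obtain ⟨t, hts, htf, hcov⟩ := Metric.finite_approx_of_totallyBounded htb (ε ^ 2 / 2)
    (by positivity)
  have hsub : ∀ S : H →L[ℂ] H, t ⊆ S '' Metric.closedBall 0 1 →
      S '' Metric.closedBall 0 1 ⊆ ⋃ y ∈ t, Metric.ball y (ε ^ 2 / 2) →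
      ∃ t' ⊆ Metric.closedBall (0 : H) 1, t'.Finite ∧
        S '' Metric.closedBall 0 1 ⊆ ⋃ y ∈ S '' t', Metric.ball y (ε ^ 2 / 2) :=
    fun S h1 h2 => (Set.exists_subset_image_finite_and (f := S) (p := fun t =>
      S '' Metric.closedBall 0 1 ⊆ ⋃ y ∈ t, Metric.ball y (ε ^ 2 / 2))).1 ⟨t, h1, htf, h2⟩
  obtain ⟨t', ht', htf', hcov⟩ := hsub _ hts hcov
  refine ⟨(star T : H →L[ℂ] H) '' t', htf'.image _, ?_⟩
  rintro _ ⟨x, hx, rfl⟩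
  obtain ⟨_, ⟨y, hy, rfl⟩, hxy⟩ := Set.mem_iUnion₂.1 (hcov ⟨x, hx, rfl⟩)
  refine Set.mem_iUnion₂.2 ⟨_, ⟨y, hy, rfl⟩, ?_⟩
  have hx1 : ‖x‖ ≤ 1 := by simpa using hx
  have hy1 : ‖y‖ ≤ 1 := by simpa using ht' hy
  rw [Metric.mem_ball, dist_eq_norm] at hxy ⊢
  have key : ‖(star T) (x - y)‖ ^ 2 < ε ^ 2 := by
    calc ‖(star T) (x - y)‖ ^ 2
        = RCLike.re (inner ℂ ((star T) (x - y)) ((star T) (x - y))) :=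
          (inner_self_eq_norm_sq _).symm
      _ = RCLike.re (inner ℂ (x - y) ((T * star T) (x - y))) := by
          rw [ContinuousLinearMap.star_eq_adjoint, ContinuousLinearMap.adjoint_inner_left]; rfl
      _ ≤ ‖x - y‖ * ‖(T * star T) (x - y)‖ := re_inner_le_norm _ _
      _ ≤ 2 * ‖(T * star T) (x - y)‖ := by
          gcongr
          exact (norm_sub_le _ _).trans (by linarith)
      _ < ε ^ 2 := by
          rw [map_sub]
          linarith
  have := lt_of_pow_lt_pow_left₀ 2 hε.le key
  simpa [map_sub] using this

theorem isCompactOperator_mul_left (S : H →L[ℂ] H) {T : H →L[ℂ] H} (hT : IsCompactOperator T) :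
    IsCompactOperator (S * T : H →L[ℂ] H) := hT.clm_comp S

theorem isCompactOperator_mul_right {S : H →L[ℂ] H} (hS : IsCompactOperator S) (T : H →L[ℂ] H) :
    IsCompactOperator (S * T : H →L[ℂ] H) := hS.comp_clm T

theorem isCompactOperator_rankOne (x y : H) :
    IsCompactOperator (InnerProductSpace.rankOne ℂ x y : H →L[ℂ] H) := by
  rw [InnerProductSpace.rankOne_def']
  exact (isCompactOperator_of_locallyCompactSpace_rng (ContinuousLinearMap.toSpanSingleton ℂ x)).comp_clm
    (innerSL ℂ y)

variable (H)

/-- The algebra `𝒦(H)` of compact operators. -/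
def compactOps : NonUnitalStarSubalgebra ℂ (H →L[ℂ] H) where
  carrier := {T | IsCompactOperator T}
  add_mem' hS hT := hS.add hT
  zero_mem' := isCompactOperator_zero
  mul_mem' {_ T} hS _ := isCompactOperator_mul_right hS T
  smul_mem' c _ hT := hT.smul c
  star_mem' hT := isCompactOperator_star hT

/-- `𝒦(H)` as a two-sided ideal of `ℬ(H)`. -/
def compactIdeal : TwoSidedIdeal (H →L[ℂ] H) :=
  TwoSidedIdeal.mk' {T | IsCompactOperator T} isCompactOperator_zero (fun hS hT => hS.add hT)
    (fun hT => hT.neg) (fun {S _} hT => isCompactOperator_mul_left S hT)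
    (fun {_ T} hS => isCompactOperator_mul_right hS T)

/-- The Calkin algebra `𝒬(H) = ℬ(H) / 𝒦(H)`. -/
abbrev Calkin : Type _ := (compactIdeal H).ringCon.Quotient

/-- The quotient map `π : ℬ(H) → 𝒬(H)`. -/
def calkinMk : (H →L[ℂ] H) →+* Calkin H := (compactIdeal H).ringCon.mk'

variable {H}

theorem calkinMk_eq_iff {S T : H →L[ℂ] H} :
    calkinMk H S = calkinMk H T ↔ IsCompactOperator (S - T : H →L[ℂ] H) := by
  rw [calkinMk]
  refine (RingCon.eq _).trans ?_
  rw [TwoSidedIdeal.rel_iff, compactIdeal, TwoSidedIdeal.mem_mk']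
  rfl

theorem isCompactOperator_of_mem (k : compactOps H) : IsCompactOperator (k : H →L[ℂ] H) := k.2

/-- The product `T k` of a bounded operator and a compact one, as a compact operator. -/
def lmul (T : H →L[ℂ] H) (k : compactOps H) : compactOps H :=
  ⟨T * k, isCompactOperator_mul_left T (isCompactOperator_of_mem k)⟩

end Hilbert

/-! ## Extensions -/

section Extensions

universe u v w

/-- A (unital, essential) extension `0 → 𝒦(H) → E → A → 0`: `E` is a unital C*-algebra containing
`𝒦(H)` as an essential ideal. -/
structure Extension (H : Type u) [NormedAddCommGroup H] [InnerProductSpace ℂ H] [CompleteSpace H]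
    (A : Type v) [CStarAlgebra A] where
  E : Type w
  [cstar : CStarAlgebra E]
  ι : compactOps H →⋆ₙₐ[ℂ] E
  q : E →⋆ₐ[ℂ] A
  ι_injective : Function.Injective ι
  q_surjective : Function.Surjective q
  exact : ∀ e : E, q e = 0 ↔ ∃ k, ι k = e
  essential : ∀ e : E, (∀ k, e * ι k = 0) → e = 0

attribute [instance] Extension.cstar

variable {H : Type u} [NormedAddCommGroup H] [InnerProductSpace ℂ H] [CompleteSpace H]
  {A : Type v} [CStarAlgebra A] (τ : Extension.{u, v, w} H A)

/-- The rank one operator `z ↦ ⟪y, z⟫ x`. -/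
def rk (x y : H) : compactOps H := ⟨InnerProductSpace.rankOne ℂ x y, isCompactOperator_rankOne x y⟩

theorem lmul_rk (T : H →L[ℂ] H) (x y : H) : lmul T (rk x y) = rk (T x) y := by
  apply Subtype.ext
  ext z
  simp [lmul, rk]

theorem mul_rk (k : compactOps H) (x y : H) : k * rk x y = rk ((k : H →L[ℂ] H) x) y :=
  lmul_rk (k : H →L[ℂ] H) x y

theorem rk_apply_self {v : H} (hv : ‖v‖ = 1) (x : H) : (rk x v : H →L[ℂ] H) v = x := by
  simp [rk, inner_self_eq_norm_sq_to_K, hv]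

theorem lmul_injective {S T : H →L[ℂ] H} (h : ∀ k : compactOps H, lmul S k = lmul T k) :
    S = T := by
  ext x
  rcases subsingleton_or_nontrivial H with hH | hH
  · exact Subsingleton.elim _ _
  · obtain ⟨v, hv⟩ := exists_norm_eq H zero_le_one
    have := h (rk x v)
    rw [lmul_rk, lmul_rk] at this
    rw [← rk_apply_self hv (S x), this, rk_apply_self hv]

instance : IsClosed (compactOps H : Set (H →L[ℂ] H)) :=
  isClosed_setOfPred_isCompactOperator

theorem Extension.exists_rep (e : τ.E) :
    ∃ T : H →L[ℂ] H, ∀ k : compactOps H, τ.ι (lmul T k) = e * τ.ι k := by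
  rcases subsingleton_or_nontrivial H with hH | hH
  · refine ⟨0, fun k => ?_⟩
    have h0 : ∀ l : compactOps H, l = 0 := fun l =>
      Subtype.ext (ContinuousLinearMap.ext fun x => Subsingleton.elim _ _)
    rw [h0 k, h0 (lmul 0 0), map_zero, mul_zero]
  obtain ⟨v, hv⟩ := exists_norm_eq H zero_le_one
  have hex : ∀ k : compactOps H, ∃ l, τ.ι l = e * τ.ι k := fun k =>
    (τ.exact _).1 (by rw [map_mul, (τ.exact (τ.ι k)).2 ⟨k, rfl⟩, mul_zero])
  choose L hL using hex
  have hadd : ∀ k l, L (k + l) = L k + L l := fun k l => τ.ι_injective (by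
    rw [map_add, hL, hL, hL, map_add, mul_add])
  have hsmul : ∀ (c : ℂ) k, L (c • k) = c • L k := fun c k => τ.ι_injective (by
    rw [map_smul, hL, hL, map_smul, mul_smul_comm])
  have hmul : ∀ k l, L (k * l) = L k * l := fun k l => τ.ι_injective (by
    rw [map_mul, hL, hL, map_mul, mul_assoc])
  have hiso : ∀ k : compactOps H, ‖τ.ι k‖ = ‖k‖ := fun k =>
    NonUnitalStarAlgHom.norm_map τ.ι τ.ι_injective k
  have hnorm : ∀ k : compactOps H, ‖L k‖ ≤ ‖e‖ * ‖k‖ := fun k => by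
    rw [← hiso, hL, ← hiso k]
    exact norm_mul_le _ _
  have hrk_add : ∀ x y : H, rk (x + y) v = rk x v + rk y v := fun x y => by
    apply Subtype.ext
    simp [rk]
  have hrk_smul : ∀ (c : ℂ) (x : H), rk (c • x) v = c • rk x v := fun c x => by
    apply Subtype.ext
    simp [rk]
  let T : H →L[ℂ] H := LinearMap.mkContinuous
    { toFun := fun x => (L (rk x v) : H →L[ℂ] H) v
      map_add' := fun x y => by rw [hrk_add, hadd]; rfl
      map_smul' := fun c x => by rw [hrk_smul, hsmul]; rfl } ‖e‖ (fun x => by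
      have h1 : ‖(L (rk x v) : H →L[ℂ] H) v‖ ≤ ‖(L (rk x v) : H →L[ℂ] H)‖ * ‖v‖ :=
        ContinuousLinearMap.le_opNorm _ _
      have h2 : ‖(rk x v : compactOps H)‖ = ‖x‖ := by
        change ‖(InnerProductSpace.rankOne ℂ x v : H →L[ℂ] H)‖ = ‖x‖
        rw [InnerProductSpace.norm_rankOne, hv, mul_one]
      have h3 := hnorm (rk x v)
      rw [h2] at h3
      rw [hv, mul_one] at h1
      exact h1.trans h3)
  refine ⟨T, fun k => ?_⟩
  rw [← hL]
  congr 1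
  apply Subtype.ext
  ext y
  have h := congrArg (fun S : compactOps H => (S : H →L[ℂ] H) v) (hmul k (rk y v))
  simp only [mul_rk, rk_apply_self hv] at h
  exact h

/-- The canonical representation of `E` on `H` extending the identity representation of the
ideal `𝒦(H)`: `e ι(k) = ι(rep(e) k)`. -/
def Extension.repFun (e : τ.E) : H →L[ℂ] H := (τ.exists_rep e).choose

theorem Extension.repFun_spec (e : τ.E) (k : compactOps H) :
    τ.ι (lmul (τ.repFun e) k) = e * τ.ι k := (τ.exists_rep e).choose_spec k

theorem Extension.repFun_unique {e : τ.E} {T : H →L[ℂ] H}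
    (h : ∀ k, τ.ι (lmul T k) = e * τ.ι k) : τ.repFun e = T :=
  lmul_injective fun k => τ.ι_injective (by rw [h, τ.repFun_spec])

theorem lmul_mul (S T : H →L[ℂ] H) (k : compactOps H) : lmul (S * T) k = lmul S (lmul T k) :=
  Subtype.ext (mul_assoc _ _ _)

theorem lmul_add (S T : H →L[ℂ] H) (k : compactOps H) : lmul (S + T) k = lmul S k + lmul T k :=
  Subtype.ext (add_mul _ _ _)

theorem star_lmul_mul (T : H →L[ℂ] H) (k l : compactOps H) :
    star l * lmul (star T) k = star (lmul T l) * k := by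
  apply Subtype.ext
  change star (l : H →L[ℂ] H) * (star T * (k : H →L[ℂ] H)) = star (T * (l : H →L[ℂ] H)) * k
  rw [star_mul, mul_assoc]

theorem eq_zero_of_star_mul {m : compactOps H} (h : ∀ l : compactOps H, star l * m = 0) :
    m = 0 := by
  apply Subtype.ext
  have := congrArg (fun S : compactOps H => (S : H →L[ℂ] H)) (h m)
  exact CStarRing.star_mul_self_eq_zero_iff _ |>.1 this

/-- `Extension.repFun` as a unital *-homomorphism `E → ℬ(H)`. -/
def Extension.rep : τ.E →⋆ₐ[ℂ] (H →L[ℂ] H) where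
  toFun := τ.repFun
  map_one' := τ.repFun_unique fun k => by
    rw [one_mul]
    exact congrArg τ.ι (Subtype.ext (one_mul _))
  map_mul' a b := τ.repFun_unique fun k => by
    rw [lmul_mul, τ.repFun_spec, τ.repFun_spec, mul_assoc]
  map_zero' := τ.repFun_unique fun k => by
    rw [zero_mul, ← map_zero τ.ι]
    exact congrArg τ.ι (Subtype.ext (zero_mul _))
  map_add' a b := τ.repFun_unique fun k => by
    rw [lmul_add, map_add, τ.repFun_spec, τ.repFun_spec, add_mul]
  commutes' c := τ.repFun_unique fun k => by
    rw [Algebra.algebraMap_eq_smul_one, Algebra.algebraMap_eq_smul_one, smul_mul_assoc, one_mul,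
      ← map_smul]
    refine congrArg τ.ι (Subtype.ext ?_)
    change (c • (1 : H →L[ℂ] H)) * (k : H →L[ℂ] H) = c • (k : H →L[ℂ] H)
    rw [smul_mul_assoc, one_mul]
  map_star' a := τ.repFun_unique fun k => by
    obtain ⟨m, hm⟩ := (τ.exact (τ.ι (lmul (star (τ.repFun a)) k) - star a * τ.ι k)).1 (by
      rw [map_sub, map_mul, (τ.exact (τ.ι k)).2 ⟨k, rfl⟩, mul_zero, sub_zero]
      exact (τ.exact _).2 ⟨_, rfl⟩)
    have h0 : m = 0 := eq_zero_of_star_mul fun l => τ.ι_injective (by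
      rw [map_mul, hm, mul_sub, ← map_mul, star_lmul_mul, map_mul, map_star, map_star,
        τ.repFun_spec, star_mul, mul_assoc, sub_self, map_zero])
    rw [h0, map_zero] at hm
    exact (sub_eq_zero.1 hm.symm)

theorem Extension.rep_ι (k : compactOps H) : τ.rep (τ.ι k) = k :=
  τ.repFun_unique fun l => by rw [← map_mul]; rfl

/-- The Busby invariant `τ : A → 𝒬(H)` of an extension: it sends `q(e)` to the class of
`rep(e)`. -/
def Extension.busby : A →+* Calkin H :=
  (τ.q : τ.E →+* A).liftOfSurjective τ.q_surjective
    ⟨(calkinMk H).comp (τ.rep : τ.E →+* (H →L[ℂ] H)), fun e he => by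
      obtain ⟨k, rfl⟩ := (τ.exact e).1 he
      change calkinMk H (τ.rep (τ.ι k)) = 0
      rw [τ.rep_ι, ← map_zero (calkinMk H), calkinMk_eq_iff, sub_zero]
      exact k.2⟩

theorem Extension.busby_q (e : τ.E) : τ.busby (τ.q e) = calkinMk H (τ.rep e) :=
  RingHom.liftOfRightInverse_comp_apply (τ.q : τ.E →+* A) _ _ _ e

/-- Strong equivalence of extensions: the Busby invariants are conjugate by (the image in the
Calkin algebra of) a unitary operator on `H`. -/
def StrongEquiv (τ₁ τ₂ : Extension.{u, v, w} H A) : Prop :=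
  ∃ U ∈ unitary (H →L[ℂ] H), ∀ a : A,
    τ₂.busby a = calkinMk H U * τ₁.busby a * calkinMk H (star U)

end Extensions

/-! ## K-homology through dual algebras -/

section DualAlgebra

variable {H : Type*} [NormedAddCommGroup H] [InnerProductSpace ℂ H] [CompleteSpace H]
  {B : Type*} [Ring B] [StarRing B] [Algebra ℂ B]

/-- A (unital, hence nondegenerate) representation is ample if only `0` acts as a compact
operator. -/
def IsAmple (ρ : B →⋆ₐ[ℂ] (H →L[ℂ] H)) : Prop :=
  ∀ b : B, IsCompactOperator (ρ b) → b = 0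

/-- The dual algebra `𝔇_ρ(B)`: the operators commuting with `ρ(B)` modulo compact operators. -/
def dualAlgebra (ρ : B →⋆ₐ[ℂ] (H →L[ℂ] H)) : StarSubalgebra ℂ (H →L[ℂ] H) where
  carrier := {T | ∀ b : B, IsCompactOperator (T * ρ b - ρ b * T : H →L[ℂ] H)}
  mul_mem' {S T} hS hT b := by
    have h : S * T * ρ b - ρ b * (S * T) =
        S * (T * ρ b - ρ b * T) + (S * ρ b - ρ b * S) * T := by noncomm_ring
    rw [h]
    exact (isCompactOperator_mul_left S (hT b)).add (isCompactOperator_mul_right (hS b) T)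
  add_mem' {S T} hS hT b := by
    have h : (S + T) * ρ b - ρ b * (S + T) =
        (S * ρ b - ρ b * S) + (T * ρ b - ρ b * T) := by noncomm_ring
    rw [h]
    exact (hS b).add (hT b)
  algebraMap_mem' c b := by
    rw [Algebra.commutes, sub_self]
    exact isCompactOperator_zero
  star_mem' {T} hT b := by
    have h : star T * ρ b - ρ b * star T = -star (T * ρ (star b) - ρ (star b) * T) := by
      simp [map_star]
    rw [h]
    exact (isCompactOperator_star (hT (star b))).neg

theorem mem_dualAlgebra {ρ : B →⋆ₐ[ℂ] (H →L[ℂ] H)} {T : H →L[ℂ] H} :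
    T ∈ dualAlgebra ρ ↔ ∀ b : B, IsCompactOperator (T * ρ b - ρ b * T : H →L[ℂ] H) := Iff.rfl

variable (H)

/-- The inclusion of `H` as the first summand of `H ⊕ H`. -/
def inl : H →L[ℂ] WithLp 2 (H × H) :=
  ((WithLp.prodContinuousLinearEquiv 2 ℂ H H).symm : H × H →L[ℂ] WithLp 2 (H × H)) ∘L
    ContinuousLinearMap.inl ℂ H H

theorem adjoint_inl_comp_inl :
    (ContinuousLinearMap.adjoint (inl H)) ∘L (inl H) = ContinuousLinearMap.id ℂ H := by
  ext x
  refine ext_inner_left ℂ fun y => ?_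
  rw [ContinuousLinearMap.comp_apply, ContinuousLinearMap.adjoint_inner_right]
  simp [inl, WithLp.prod_inner_apply]

variable {H}

/-- The upper left entry of an operator on `H ⊕ H`. -/
def upperLeft (T : WithLp 2 (H × H) →L[ℂ] WithLp 2 (H × H)) : H →L[ℂ] H :=
  (ContinuousLinearMap.adjoint (inl H)) ∘L T ∘L (inl H)

variable (H)

/-- The upper left corner embedding `T ↦ T ⊕ 0` of `ℬ(H)` into `ℬ(H ⊕ H)`. -/
def corner : (H →L[ℂ] H) →⋆ₙₐ[ℂ] (WithLp 2 (H × H) →L[ℂ] WithLp 2 (H × H)) where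
  toFun T := (inl H) ∘L T ∘L (ContinuousLinearMap.adjoint (inl H))
  map_smul' c T := ContinuousLinearMap.ext fun x => by simp
  map_zero' := ContinuousLinearMap.ext fun x => by simp
  map_add' S T := ContinuousLinearMap.ext fun x => by simp
  map_mul' S T := by
    have h : ∀ x, (ContinuousLinearMap.adjoint (inl H)) (inl H x) = x := fun x =>
      congrArg (fun f : H →L[ℂ] H => f x) (adjoint_inl_comp_inl H)
    refine ContinuousLinearMap.ext fun x => ?_
    simp [h]
  map_star' T := by
    simp [ContinuousLinearMap.star_eq_adjoint, ContinuousLinearMap.adjoint_comp,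
      ContinuousLinearMap.comp_assoc]

theorem corner_continuous : Continuous (corner H) :=
  continuous_const.clm_comp (continuous_id.clm_comp continuous_const)

variable {H}

theorem isCompactOperator_corner {T : H →L[ℂ] H} (hT : IsCompactOperator T) :
    IsCompactOperator (corner H T) :=
  (hT.comp_clm (ContinuousLinearMap.adjoint (inl H))).clm_comp (inl H)

variable {A : Type*} [CStarAlgebra A]

/-- The representation `(a, c) ↦ (ρ(a) + c) ⊕ c` of the unitization `A⁺` on `H ⊕ H`. It is ample if
`ρ` is ample and `H` is infinite dimensional. -/
def unitizedRep (ρ : A →⋆ₐ[ℂ] (H →L[ℂ] H)) :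
    Unitization ℂ A →⋆ₐ[ℂ] (WithLp 2 (H × H) →L[ℂ] WithLp 2 (H × H)) :=
  Unitization.starLift ((corner H).comp ρ.toNonUnitalStarAlgHom)

theorem unitizedRep_apply (ρ : A →⋆ₐ[ℂ] (H →L[ℂ] H)) (x : Unitization ℂ A) :
    unitizedRep ρ x = algebraMap ℂ _ x.fst + corner H (ρ x.snd) := rfl

variable (H) in
/-- The representation of `ℂ` on `H` by scalars; `𝔇(ℂ) = ℬ(H)`. -/
def scalarRep : ℂ →⋆ₐ[ℂ] (H →L[ℂ] H) := StarAlgHom.ofId ℂ (H →L[ℂ] H)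

theorem commutator_unitizedRep (ρ : A →⋆ₐ[ℂ] (H →L[ℂ] H))
    (T : WithLp 2 (H × H) →L[ℂ] WithLp 2 (H × H)) (x : Unitization ℂ A) :
    T * unitizedRep ρ x - unitizedRep ρ x * T =
      T * corner H (ρ x.snd) - corner H (ρ x.snd) * T := by
  rw [unitizedRep_apply, mul_add, add_mul, Algebra.commutes]
  abel

theorem corner_mem (ρ : A →⋆ₐ[ℂ] (H →L[ℂ] H)) {T : H →L[ℂ] H} (hT : T ∈ dualAlgebra ρ) :
    corner H T ∈ dualAlgebra (unitizedRep ρ) := fun x => by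
  rw [commutator_unitizedRep, ← map_mul, ← map_mul, ← map_sub]
  exact isCompactOperator_corner (hT x.snd)

/-- The corner embedding `𝔇(A) → 𝔇(A⁺)`. -/
def dualCorner (ρ : A →⋆ₐ[ℂ] (H →L[ℂ] H)) :
    dualAlgebra ρ →⋆ₙₐ[ℂ] dualAlgebra (unitizedRep ρ) where
  toFun T := ⟨corner H T, corner_mem ρ T.2⟩
  map_smul' c T := Subtype.ext (map_smul (corner H) c (T : H →L[ℂ] H))
  map_zero' := Subtype.ext (map_zero (corner H))
  map_add' S T := Subtype.ext (map_add (corner H) (S : H →L[ℂ] H) T)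
  map_mul' S T := Subtype.ext (map_mul (corner H) (S : H →L[ℂ] H) T)
  map_star' T := Subtype.ext (map_star (corner H) (T : H →L[ℂ] H))

theorem dualCorner_continuous (ρ : A →⋆ₐ[ℂ] (H →L[ℂ] H)) : Continuous (dualCorner ρ) :=
  Continuous.subtype_mk ((corner_continuous H).comp continuous_subtype_val) _

theorem dualAlgebra_le (ρ : A →⋆ₐ[ℂ] (H →L[ℂ] H)) :
    dualAlgebra (unitizedRep ρ) ≤ dualAlgebra (unitizedRep (scalarRep H)) := fun T hT x => by
  have h := hT (Unitization.inr (x.snd • (1 : A)))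
  rw [commutator_unitizedRep] at h ⊢
  have h2 : ρ (Unitization.inr (x.snd • (1 : A)) : Unitization ℂ A).snd = scalarRep H x.snd := by
    rw [Unitization.snd_inr, map_smul, map_one, ← Algebra.algebraMap_eq_smul_one]
    rfl
  rwa [h2] at h

/-- The inclusion `𝔇(A⁺) → 𝔇(ℂ⁺)`; it induces the map on K-homology given by the unital inclusion
`ℂ → A`, as the representation of `A⁺` on `H ⊕ H` restricts to that of `ℂ⁺`. -/
def dualInclusion (ρ : A →⋆ₐ[ℂ] (H →L[ℂ] H)) :
    dualAlgebra (unitizedRep ρ) →⋆ₐ[ℂ] dualAlgebra (unitizedRep (scalarRep H)) :=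
  StarSubalgebra.inclusion (dualAlgebra_le ρ)

theorem dualInclusion_continuous (ρ : A →⋆ₐ[ℂ] (H →L[ℂ] H)) : Continuous (dualInclusion ρ) :=
  Continuous.subtype_mk continuous_subtype_val _

variable (ρ : A →⋆ₐ[ℂ] (H →L[ℂ] H))

/-- Reduced K-homology `K̃⁰(A) = K₁(𝔇(A))`. -/
abbrev RedKHom0 : Type _ := K1 (dualAlgebra ρ)

/-- Reduced K-homology `K̃¹(A) = K₀(𝔇(A))`. -/
abbrev RedKHom1 : Type _ := K0 (dualAlgebra ρ)

/-- K-homology `K⁰(A) = K₁(𝔇(A⁺))`. -/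
abbrev KHom0 : Type _ := K1 (dualAlgebra (unitizedRep ρ))

/-- K-homology `K¹(A) = K₀(𝔇(A⁺))`. -/
abbrev KHom1 : Type _ := K0 (dualAlgebra (unitizedRep ρ))

variable (H) in
/-- `K⁰(ℂ) = K₁(𝔇(ℂ⁺))`. -/
abbrev KHom0Scalar : Type _ := KHom0 (scalarRep H)

/-- `j⁰ : K̃⁰(A) → K⁰(A)`, induced by the upper left corner inclusion. -/
def j0 : RedKHom0 ρ →+ KHom0 ρ := K1.map (dualCorner ρ) (dualCorner_continuous ρ)

/-- `j¹ : K̃¹(A) → K¹(A)`, induced by the upper left corner inclusion. -/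
def j1 : RedKHom1 ρ →+ KHom1 ρ := K0.map (dualCorner ρ)

/-- `ι_ℂ^* : K⁰(A) → K⁰(ℂ)`, induced by the unital inclusion `ℂ → A`. -/
def unitPullback : KHom0 ρ →+ KHom0Scalar H :=
  K1.map (dualInclusion ρ).toNonUnitalStarAlgHom (dualInclusion_continuous ρ)

/-- `IsExtClass ρ β x`: under the identification `K̃¹(A) = Ext_s(A)`, the class of the extension
with Busby invariant `β` is `x`. The class of a projection `P = V V*` of `𝔇_ρ(A)`, where `V` is an
isometry of `H` onto the range of `P`, corresponds to the extension `a ↦ π(V* ρ(a) V)`. -/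
def IsExtClass (β : A → Calkin H) (x : RedKHom1 ρ) : Prop :=
  ∃ (V : H →L[ℂ] H) (P : dualAlgebra ρ) (hP : IsStarProjection P),
    star V * V = 1 ∧ (P : H →L[ℂ] H) = V * star V ∧
    (∀ a, β a = calkinMk H (star V * ρ a * V)) ∧ x = K0.ofElem P hP

/-- The class of a unitary `W` of `𝔇(ℂ⁺)` in `K⁰(ℂ)` is `x`, and `T` is the upper left entry of
`W`: a Fredholm operator whose image in `𝒬(H)` is a unitary with class `x` under
`K⁰(ℂ) = K₁(𝒬(H))`. -/
def IsScalarClass (x : KHom0Scalar H) (T : H →L[ℂ] H) : Prop :=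
  ∃ W : unitary (Matrix (Fin 1) (Fin 1) (dualAlgebra (unitizedRep (scalarRep H)))),
    x = K1.mk W ∧ T = upperLeft (W.1 0 0).1

/-- The identification `K⁰(ℂ) = ℤ` by the Fredholm index: `x` corresponds to `n`. -/
def HasIndex (x : KHom0Scalar H) (n : ℤ) : Prop :=
  ∃ T : H →L[ℂ] H, IsScalarClass x T ∧
    n = (Module.finrank ℂ (T : H →ₗ[ℂ] H).ker : ℤ) -
      Module.finrank ℂ ((star T : H →L[ℂ] H) : H →ₗ[ℂ] H).ker

/-- The graph of `ι_A : K⁰(ℂ) → K̃¹(A) = Ext_s(A)`, which sends the class of a unitary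
`u ∈ 𝒬(H)` to the class of the extension `Ad(u) ∘ π ∘ ρ`, where `π ∘ ρ` is the trivial
extension. -/
def IsIota (x : KHom0Scalar H) (y : RedKHom1 ρ) : Prop :=
  ∃ T : H →L[ℂ] H, IsScalarClass x T ∧
    IsExtClass ρ (fun a => calkinMk H (T * ρ a * star T)) y

end DualAlgebra

/-! ## K-theory of an extension, and duality -/

section Duality

universe u v v' w w'

variable {H : Type u} [NormedAddCommGroup H] [InnerProductSpace ℂ H] [CompleteSpace H]
  {A : Type v} [CStarAlgebra A] {A' : Type v'} [CStarAlgebra A']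

variable (H) in
/-- `K₀(𝒦(H))`. -/
abbrev K0Compact : Type _ := K0NonUnital (compactOps H)

/-- The projection `1_n ⊕ 0_n` over `R`. -/
def Proj.half (R : Type*) [Ring R] [StarRing R] (n : ℕ) : Proj R where
  size := n + n
  mat := dsum 1 0
  isProj := by
    refine ⟨?_, ?_⟩
    · rw [IsIdempotentElem, dsum_mul, one_mul, zero_mul]
    · rw [IsSelfAdjoint, star_dsum, star_one, star_zero]

namespace Extension

variable (τ : Extension.{u, v, w} H A)

theorem q_continuous : Continuous τ.q :=
  AddMonoidHomClass.continuous_of_bound τ.q 1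
    (by simpa only [one_mul] using NonUnitalStarAlgHom.norm_apply_le τ.q)

/-- `q_* : K₁(E) → K₁(A)`. -/
def qK1 : K1 τ.E →+ K1 A :=
  K1.map τ.q.toNonUnitalStarAlgHom τ.q_continuous

/-- `q_* : K₀(E) → K₀(A)`. -/
def qK0 : K0 τ.E →+ K0 A := K0.map τ.q.toNonUnitalStarAlgHom

/-- `ι_* : K₀(𝒦(H)) → K₀(E)`. -/
def ιK0 : K0Compact H →+ K0 τ.E := K0NonUnital.map τ.ι

/-- The graph of the index map `∂ : K₁(A) → K₀(𝒦(H))`: if `u ∈ U_n(A)`, `w ∈ U_{2n}(E)` lifts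
`u ⊕ u*`, and `P` is the projection over `𝒦(H)⁺` corresponding to `w (1_n ⊕ 0) w*`, then
`∂[u] = [P] - [1_n ⊕ 0]`. -/
def IsIndexMap (y : K1 A) (z : K0Compact H) : Prop :=
  ∃ (n : ℕ) (u : unitary (Matrix (Fin n) (Fin n) A))
    (w : unitary (Matrix (Fin (n + n)) (Fin (n + n)) τ.E))
    (P : Matrix (Fin (n + n)) (Fin (n + n)) (Unitization ℂ (compactOps H)))
    (hP : IsStarProjection P),
    (w : Matrix (Fin (n + n)) (Fin (n + n)) τ.E).map τ.q =
      dsum (u : Matrix (Fin n) (Fin n) A) (star (u : Matrix (Fin n) (Fin n) A)) ∧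
    P.map (Unitization.starLift τ.ι) =
      (w : Matrix (Fin (n + n)) (Fin (n + n)) τ.E) * dsum 1 0 *
        star (w : Matrix (Fin (n + n)) (Fin (n + n)) τ.E) ∧
    y = K1.mk u ∧
    (z : K0 (Unitization ℂ (compactOps H))) =
      K0.mk ⟨n + n, P, hP⟩ - K0.mk (Proj.half _ n)

end Extension

/-- Horizontal isomorphisms from the K-homology sequence of `A` (computed with the ample
representation `ρ`) to the K-theory sequence of an extension `τ'` of `A'`, making the diagram
commutative. -/
structure DualityDiagram (ρ : A →⋆ₐ[ℂ] (H →L[ℂ] H)) (τ' : Extension.{u, v', w'} H A') where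
  redΦ0 : RedKHom0 ρ ≃+ K1 τ'.E
  Φ0 : KHom0 ρ ≃+ K1 A'
  Φscalar : KHom0Scalar H ≃+ K0Compact H
  redΦ1 : RedKHom1 ρ ≃+ K0 τ'.E
  Φ1 : KHom1 ρ ≃+ K0 A'
  comm_j0 : ∀ x, τ'.qK1 (redΦ0 x) = Φ0 (j0 ρ x)
  comm_index : ∀ x, τ'.IsIndexMap (Φ0 x) (Φscalar (unitPullback ρ x))
  comm_iota : ∀ x, ∃ y, IsIota ρ x y ∧ τ'.ιK0 (Φscalar x) = redΦ1 y
  comm_j1 : ∀ x, τ'.qK0 (redΦ1 x) = Φ1 (j1 ρ x)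

/-- The conditions on a diagram in a strong duality pair: `Φscalar` is the identity under
`K⁰(ℂ) = ℤ` (Fredholm index) and `K₀(𝒦(H)) = ℤ` (class of a rank one projection), and
`[τ]_s` is sent to `-[1_{E'}]`. -/
structure DualityDiagram.IsStrong {ρ : A →⋆ₐ[ℂ] (H →L[ℂ] H)} {τ' : Extension.{u, v', w'} H A'}
    (D : DualityDiagram ρ τ') (τ : Extension.{u, v, w} H A) : Prop where
  scalar_eq_id : ∀ (x : KHom0Scalar H) (n : ℤ), HasIndex x n →
    ∀ (e : compactOps H)
      (he : IsStarProjection (Unitization.inr e : Unitization ℂ (compactOps H))),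
      Module.finrank ℂ ((e : H →L[ℂ] H) : H →ₗ[ℂ] H).range = 1 →
      (D.Φscalar x : K0 (Unitization ℂ (compactOps H))) = n • K0.ofElem (Unitization.inr e) he
  map_class : ∃ x, IsExtClass ρ τ.busby x ∧ D.redΦ1 x = -K0.one τ'.E

/-- `τ` and `τ'` are a K-theoretic duality pair. (K-homology of `A`, `A'` is computed with the
ample representations `ρ`, `ρ'`.) -/
def IsDualityPair (ρ : A →⋆ₐ[ℂ] (H →L[ℂ] H)) (ρ' : A' →⋆ₐ[ℂ] (H →L[ℂ] H))
    (τ : Extension.{u, v, w} H A) (τ' : Extension.{u, v', w'} H A') : Prop :=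
  Nonempty (DualityDiagram ρ τ') ∧ Nonempty (DualityDiagram ρ' τ)

/-- `τ` and `τ'` are a strong K-theoretic duality pair. -/
def IsStrongDualityPair (ρ : A →⋆ₐ[ℂ] (H →L[ℂ] H)) (ρ' : A' →⋆ₐ[ℂ] (H →L[ℂ] H))
    (τ : Extension.{u, v, w} H A) (τ' : Extension.{u, v', w'} H A') : Prop :=
  (∃ D : DualityDiagram ρ τ', D.IsStrong τ) ∧ ∃ D : DualityDiagram ρ' τ, D.IsStrong τ'

end Duality

section Nuclear

open scoped CStarAlgebra ComplexOrder

/-- Nuclearity, as the completely positive approximation property: the identity of `A` is a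
point-norm limit of maps which factor through matrix algebras `M_n(ℂ)` by contractive completely
positive maps. -/
def IsNuclear (A : Type*) [CStarAlgebra A] : Prop :=
  letI := CStarAlgebra.spectralOrder A
  haveI := CStarAlgebra.spectralOrderedRing A
  ∀ (F : Finset A) (ε : ℝ), 0 < ε →
    ∃ (n : ℕ) (φ : A →CP CStarMatrix (Fin n) (Fin n) ℂ)
      (ψ : CStarMatrix (Fin n) (Fin n) ℂ →CP A),
      (∀ a, ‖φ a‖ ≤ ‖a‖) ∧ (∀ x, ‖ψ x‖ ≤ ‖x‖) ∧ ∀ a ∈ F, ‖ψ (φ a) - a‖ < ε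

end Nuclear

end

end KDuality

namespace KDuality

noncomputable section

set_option linter.unusedSectionVars false

open Matrix

/-! ## Functoriality of K-theory -/

section Functoriality

variable {R S T : Type*} [Ring R] [StarRing R] [Algebra ℂ R] [Ring S] [StarRing S] [Algebra ℂ S]
  [Ring T] [StarRing T] [Algebra ℂ T]

/-! In a duality diagram the K-homology side depends only on the ample representation, so an
extension enters only through its algebra, its maps `ι` and `q`, and, in the strong case, its class
in Ext_s. All of these are controlled by a unitary `U` implementing a strong equivalence.

The algebra of an extension is the pullback of its Busby invariant along π: an element is determined
by its image in ℬ(H) and its image in the quotient, and every compatible pair occurs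
(`Extension.rep_q_injective`, `Extension.exists_rep_eq_q_eq`). If the Busby invariants are conjugate
by π(U), then Ad(U) on ℬ(H) and the identity on the quotient therefore give an isomorphism of the
two algebras which is Ad(U) on 𝒦(H) (`StrongEquiv.nonempty_iso`). Composing the isomorphisms of a
diagram with the maps it induces on K-theory gives a diagram for the new extension, since `q_*`,
`ι_*` and the index map are natural (`DualityDiagram.transport`).

For strong pairs, Ad(U) permutes the rank one projections and the isomorphism is unital, so both
normalizations survive (`DualityDiagram.IsStrong.transport`). The class in Ext_s does not change
either: if an isometry V represents it, then VU* represents the conjugated extension and has the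
same range projection (`IsExtClass.conj`). The converse implications follow by symmetry of strong
equivalence. -/

theorem K0.map_mk (φ : R →⋆ₙₐ[ℂ] S) (p : Proj R) : K0.map φ (K0.mk p) = K0.mk (p.map φ) := by
  change FreeAbelianGroup.lift _ (FreeAbelianGroup.of p) = _
  rw [FreeAbelianGroup.lift_apply_of]

/-- The group is a quotient of a free abelian group, so a homomorphism is determined on generators.
This reduces functoriality to a computation with matrices. -/
theorem K0.hom_ext {G : Type*} [AddGroup G] {f g : K0 R →+ G}
    (h : ∀ p, f (K0.mk p) = g (K0.mk p)) (x : K0 R) : f x = g x := by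
  obtain ⟨y, rfl⟩ := QuotientAddGroup.mk_surjective x
  induction y using FreeAbelianGroup.induction_on with
  | zero => exact (map_zero f).trans (map_zero g).symm
  | of p => exact h p
  | neg p hp => exact ((map_neg f _).trans (congrArg _ hp)).trans (map_neg g _).symm
  | add a b ha hb =>
    exact ((map_add f _ _).trans (congrArg₂ _ ha hb)).trans (map_add g _ _).symm

/-- The composite is a separate map `χ` with a pointwise hypothesis, so that the same lemma serves
for mutually inverse maps and for commuting triangles and squares. -/
theorem K0.map_map {φ : S →⋆ₙₐ[ℂ] T} {ψ : R →⋆ₙₐ[ℂ] S} {χ : R →⋆ₙₐ[ℂ] T}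
    (h : ∀ r, φ (ψ r) = χ r) (x : K0 R) : K0.map φ (K0.map ψ x) = K0.map χ x := by
  refine K0.hom_ext (f := (K0.map φ).comp (K0.map ψ)) (fun p => ?_) x
  rw [AddMonoidHom.comp_apply, K0.map_mk, K0.map_mk, K0.map_mk]
  have hp : (p.map ψ).map φ = p.map χ := by
    simp only [Proj.map]
    congr 1
    ext i j
    exact h _
  rw [hp]

theorem K0.map_id {φ : R →⋆ₙₐ[ℂ] R} (h : ∀ r, φ r = r) (x : K0 R) : K0.map φ x = x := by
  refine K0.hom_ext (g := AddMonoidHom.id _) (fun p => ?_) x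
  rw [K0.map_mk, AddMonoidHom.id_apply]
  have hp : p.map φ = p := by
    simp only [Proj.map]
    congr 1
    ext i j
    exact h _
  rw [hp]

/-- The image `p'` is kept free so that it can be given directly as the unit or as a prescribed rank
one projection. -/
theorem K0.map_ofElem (φ : R →⋆ₙₐ[ℂ] S) {p : R} (hp : IsStarProjection p) {p' : S}
    (hp' : IsStarProjection p') (h : φ p = p') : K0.map φ (K0.ofElem p hp) = K0.ofElem p' hp' := by
  subst h
  rw [K0.ofElem, K0.map_mk, K0.ofElem]
  congr 1
  simp only [Proj.map]
  congr 1
  rw [diagonal_map (map_zero φ)]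

/-- The isomorphism of `K₀`-groups induced by mutually inverse *-homomorphisms. -/
def K0.congr (φ : R →⋆ₙₐ[ℂ] S) (ψ : S →⋆ₙₐ[ℂ] R) (h : ∀ r, ψ (φ r) = r) (h' : ∀ s, φ (ψ s) = s) :
    K0 R ≃+ K0 S where
  toFun := K0.map φ
  invFun := K0.map ψ
  left_inv x := (K0.map_map (χ := NonUnitalStarAlgHom.id ℂ R) h x).trans (K0.map_id (fun _ => rfl) x)
  right_inv x :=
    (K0.map_map (χ := NonUnitalStarAlgHom.id ℂ S) h' x).trans (K0.map_id (fun _ => rfl) x)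
  map_add' := map_add _

variable [TopologicalSpace R] [TopologicalSpace S] [TopologicalSpace T]

theorem K1.hom_ext {G : Type*} [AddGroup G] {f g : K1 R →+ G}
    (h : ∀ (n : ℕ) (u : unitary (Matrix (Fin n) (Fin n) R)), f (K1.mk u) = g (K1.mk u))
    (x : K1 R) : f x = g x := by
  obtain ⟨y, rfl⟩ := QuotientAddGroup.mk_surjective x
  induction y using FreeAbelianGroup.induction_on with
  | zero => exact (map_zero f).trans (map_zero g).symm
  | of u => exact h u.size u.mat
  | neg u hu => exact ((map_neg f _).trans (congrArg _ hu)).trans (map_neg g _).symm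
  | add a b ha hb =>
    exact ((map_add f _ _).trans (congrArg₂ _ ha hb)).trans (map_add g _ _).symm

variable [IsTopologicalRing R] [IsTopologicalRing S] [IsTopologicalRing T]

theorem K1.map_mk (φ : R →⋆ₙₐ[ℂ] S) (hφ : Continuous φ) {n : ℕ}
    (u : unitary (Matrix (Fin n) (Fin n) R)) :
    K1.map φ hφ (K1.mk u) = K1.mk (UnitaryMat.mapMat φ u) := by
  change FreeAbelianGroup.lift _ (FreeAbelianGroup.of _) = _
  rw [FreeAbelianGroup.lift_apply_of]

/-- The correction terms `1 - φ(1)` for non-unital maps telescope: φ(ψ(u) + 1 - ψ(1)) + 1 - φ(1) =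
χ(u) + 1 - χ(1). -/
theorem K1.map_map {φ : S →⋆ₙₐ[ℂ] T} {hφ : Continuous φ} {ψ : R →⋆ₙₐ[ℂ] S} {hψ : Continuous ψ}
    {χ : R →⋆ₙₐ[ℂ] T} {hχ : Continuous χ}
    (h : ∀ r, φ (ψ r) = χ r) (x : K1 R) :
    K1.map φ hφ (K1.map ψ hψ x) = K1.map χ hχ x := by
  refine K1.hom_ext (f := (K1.map φ hφ).comp (K1.map ψ hψ)) (fun n u => ?_) x
  rw [AddMonoidHom.comp_apply, K1.map_mk, K1.map_mk, K1.map_mk]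
  congr 1
  apply Subtype.ext
  ext i j
  simp [UnitaryMat.mapMat, h, add_assoc]

theorem K1.map_id {φ : R →⋆ₙₐ[ℂ] R} {hφ : Continuous φ} (h : ∀ r, φ r = r) (x : K1 R) :
    K1.map φ hφ x = x := by
  refine K1.hom_ext (g := AddMonoidHom.id _) (fun n u => ?_) x
  rw [K1.map_mk, AddMonoidHom.id_apply]
  congr 1
  apply Subtype.ext
  ext i j
  simp [UnitaryMat.mapMat, h]

/-- The isomorphism of `K₁`-groups induced by mutually inverse continuous *-homomorphisms. -/
def K1.congr (φ : R →⋆ₙₐ[ℂ] S) (hφ : Continuous φ) (ψ : S →⋆ₙₐ[ℂ] R) (hψ : Continuous ψ)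
    (h : ∀ r, ψ (φ r) = r) (h' : ∀ s, φ (ψ s) = s) : K1 R ≃+ K1 S where
  toFun := K1.map φ hφ
  invFun := K1.map ψ hψ
  left_inv x := (K1.map_map (χ := NonUnitalStarAlgHom.id ℂ R) (hχ := continuous_id) h x).trans
    (K1.map_id (fun _ => rfl) x)
  right_inv x := (K1.map_map (χ := NonUnitalStarAlgHom.id ℂ S) (hχ := continuous_id) h' x).trans
    (K1.map_id (fun _ => rfl) x)
  map_add' := map_add _

end Functoriality

/-! ### Functoriality of K₀ for non-unital algebras. -/

section FunctorialityNonUnital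

variable {I J : Type*} [NonUnitalRing I] [StarRing I] [Module ℂ I] [IsScalarTower ℂ I I]
  [SMulCommClass ℂ I I] [StarModule ℂ I] [NonUnitalRing J] [StarRing J] [Module ℂ J]
  [IsScalarTower ℂ J J] [SMulCommClass ℂ J J] [StarModule ℂ J]

theorem fst_starMap (φ : I →⋆ₙₐ[ℂ] J) (x : Unitization ℂ I) :
    (Unitization.starMap φ x).fst = x.fst := by
  simp [Unitization.algebraMap_eq_inl]

theorem snd_starMap (φ : I →⋆ₙₐ[ℂ] J) (x : Unitization ℂ I) :
    (Unitization.starMap φ x).snd = φ x.snd := by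
  simp [Unitization.algebraMap_eq_inl]

theorem starMap_starMap {φ : I →⋆ₙₐ[ℂ] J} {ψ : J →⋆ₙₐ[ℂ] I} (h : ∀ r, ψ (φ r) = r)
    (x : Unitization ℂ I) : Unitization.starMap ψ (Unitization.starMap φ x) = x := by
  ext
  · rw [fst_starMap, fst_starMap]
  · rw [snd_starMap, snd_starMap, h]

/-- A map of unitizations preserves scalar parts, hence the kernel of the map to K₀(ℂ). -/
theorem K0NonUnital.map_starMap_mem (φ : I →⋆ₙₐ[ℂ] J) {x : K0 (Unitization ℂ I)}
    (hx : x ∈ K0NonUnital I) :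
    K0.map (Unitization.starMap φ).toNonUnitalStarAlgHom x ∈ K0NonUnital J := by
  rw [K0NonUnital, AddMonoidHom.mem_ker] at hx ⊢
  rw [← hx]
  exact K0.map_map (fst_starMap φ) x

/-- The isomorphism `K₀(I) ≃ K₀(J)` induced by mutually inverse *-homomorphisms of non-unital
algebras. -/
def K0NonUnital.congr (φ : I →⋆ₙₐ[ℂ] J) (ψ : J →⋆ₙₐ[ℂ] I) (h : ∀ r, ψ (φ r) = r)
    (h' : ∀ s, φ (ψ s) = s) : K0NonUnital I ≃+ K0NonUnital J where
  toFun x := ⟨_, K0NonUnital.map_starMap_mem φ x.2⟩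
  invFun x := ⟨_, K0NonUnital.map_starMap_mem ψ x.2⟩
  left_inv x := Subtype.ext <|
    (K0.map_map (χ := NonUnitalStarAlgHom.id ℂ _)
      (starMap_starMap h) x.1).trans (K0.map_id (fun _ => rfl) _)
  right_inv x := Subtype.ext <|
    (K0.map_map (χ := NonUnitalStarAlgHom.id ℂ _)
      (starMap_starMap h') x.1).trans (K0.map_id (fun _ => rfl) _)
  map_add' _ _ := Subtype.ext (map_add _ _ _)

end FunctorialityNonUnital

/-! ## Strongly equivalent extensions have isomorphic algebras -/

section Conjugation

variable {H : Type*} [NormedAddCommGroup H] [InnerProductSpace ℂ H] [CompleteSpace H]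

/-- Conjugation `k ↦ U k U*` of compact operators by a unitary operator `U`. -/
def conjCompact (U : unitary (H →L[ℂ] H)) : compactOps H →⋆ₙₐ[ℂ] compactOps H where
  toFun k := ⟨(U : H →L[ℂ] H) * k * star (U : H →L[ℂ] H),
    isCompactOperator_mul_right (isCompactOperator_mul_left _ (isCompactOperator_of_mem k)) _⟩
  map_smul' c k := Subtype.ext (by simp)
  map_zero' := Subtype.ext (by simp)
  map_add' k l := Subtype.ext (by simp [mul_add, add_mul])
  map_mul' k l := Subtype.ext (by
    change (U : H →L[ℂ] H) * (k * l) * star (U : H →L[ℂ] H) =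
      (U * k * star (U : H →L[ℂ] H)) * (U * l * star (U : H →L[ℂ] H))
    have h : star (U : H →L[ℂ] H) * U = 1 := Unitary.coe_star_mul_self U
    calc (U : H →L[ℂ] H) * (k * l) * star (U : H →L[ℂ] H)
        = U * k * 1 * l * star (U : H →L[ℂ] H) := by noncomm_ring
      _ = _ := by rw [← h]; noncomm_ring)
  map_star' k := Subtype.ext (by
    change (U : H →L[ℂ] H) * star (k : H →L[ℂ] H) * star (U : H →L[ℂ] H) =
      star ((U : H →L[ℂ] H) * (k : H →L[ℂ] H) * star (U : H →L[ℂ] H))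
    rw [star_mul, star_mul, star_star, mul_assoc])

theorem coe_conjCompact (U : unitary (H →L[ℂ] H)) (k : compactOps H) :
    (conjCompact U k : H →L[ℂ] H) = U * k * star (U : H →L[ℂ] H) := rfl

theorem conjCompact_star_apply (U : unitary (H →L[ℂ] H)) (k : compactOps H) :
    conjCompact (star U) (conjCompact U k) = k := Subtype.ext (by
  rw [coe_conjCompact, coe_conjCompact, Unitary.coe_star, star_star]
  have h : star (U : H →L[ℂ] H) * U = 1 := Unitary.coe_star_mul_self U
  calc star (U : H →L[ℂ] H) * (U * k * star (U : H →L[ℂ] H)) * U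
      = (star (U : H →L[ℂ] H) * U) * k * (star (U : H →L[ℂ] H) * U) := by noncomm_ring
    _ = _ := by rw [h, one_mul, mul_one])

theorem conjCompact_apply_star (U : unitary (H →L[ℂ] H)) (k : compactOps H) :
    conjCompact U (conjCompact (star U) k) = k := by
  simpa only [star_star] using conjCompact_star_apply (star U) k

/-- The isomorphism `Ad(U)_*` of `K₀(𝒦(H))`. -/
def K0Compact.conj (U : unitary (H →L[ℂ] H)) : K0Compact H ≃+ K0Compact H :=
  K0NonUnital.congr (conjCompact U) (conjCompact (star U)) (conjCompact_star_apply U)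
    (conjCompact_apply_star U)

theorem K0Compact.coe_conj (U : unitary (H →L[ℂ] H)) (x : K0Compact H) :
    (K0Compact.conj U x : K0 (Unitization ℂ (compactOps H))) =
      K0.map (Unitization.starMap (conjCompact U)).toNonUnitalStarAlgHom x := rfl

/-- The range of UkU* is U applied to the range of k, because U* is onto. This keeps rank one
projections of rank one in the normalization of a strong pair. -/
theorem finrank_range_conjCompact (U : unitary (H →L[ℂ] H)) (k : compactOps H) :
    Module.finrank ℂ ((conjCompact U k : H →L[ℂ] H) : H →ₗ[ℂ] H).range =
      Module.finrank ℂ ((k : H →L[ℂ] H) : H →ₗ[ℂ] H).range := by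
  let e : H ≃ₗ[ℂ] H := (Unitary.linearIsometryEquiv U).toLinearEquiv
  have h : ((conjCompact U k : H →L[ℂ] H) : H →ₗ[ℂ] H).range =
      (((k : H →L[ℂ] H) : H →ₗ[ℂ] H).range).map (e : H →ₗ[ℂ] H) := by
    have h2 : ((conjCompact U k : H →L[ℂ] H) : H →ₗ[ℂ] H) =
        (e : H →ₗ[ℂ] H) ∘ₗ ((k : H →L[ℂ] H) : H →ₗ[ℂ] H) ∘ₗ (e.symm : H →ₗ[ℂ] H) := rfl
    rw [h2, LinearMap.range_comp, LinearMap.range_comp_of_range_eq_top _ e.symm.range]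
  rw [h]
  exact LinearEquiv.finrank_map_eq e _

end Conjugation

universe u v v' w w'

/-! ### Extension algebras as pullbacks, and lifting a conjugation of Busby invariants. -/

section StrongEquivalence

variable {H : Type u} [NormedAddCommGroup H] [InnerProductSpace ℂ H] [CompleteSpace H]
  {A : Type v} [CStarAlgebra A]

theorem StrongEquiv.symm {τ₁ τ₂ : Extension.{u, v, w} H A} (h : StrongEquiv τ₁ τ₂) :
    StrongEquiv τ₂ τ₁ := by
  obtain ⟨U, hU, h⟩ := h
  have h1 : calkinMk H (star U) * calkinMk H U = 1 := by
    rw [← map_mul, Unitary.star_mul_self_of_mem hU, map_one]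
  refine ⟨star U, Unitary.star_mem hU, fun a => ?_⟩
  rw [h, star_star]
  calc τ₁.busby a = (calkinMk H (star U) * calkinMk H U) * τ₁.busby a *
        (calkinMk H (star U) * calkinMk H U) := by rw [h1, one_mul, mul_one]
    _ = _ := by simp only [mul_assoc]

/-- An element killed by `q` is some `ι k`, and `rep` returns `k` itself. Every identity in the
extension algebra can thus be checked once in ℬ(H) and once in the quotient. -/
theorem Extension.rep_q_injective (τ : Extension.{u, v, w} H A) {e f : τ.E}
    (h : τ.rep e = τ.rep f) (h' : τ.q e = τ.q f) : e = f := by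
  obtain ⟨k, hk⟩ := (τ.exact (e - f)).1 (by rw [map_sub, h', sub_self])
  have h0 : τ.rep (e - f) = 0 := by rw [map_sub, h, sub_self]
  rw [← hk, τ.rep_ι] at h0
  have hk0 : k = 0 := Subtype.ext h0
  rw [hk0, map_zero] at hk
  exact sub_eq_zero.1 hk.symm

theorem Extension.q_ι (τ : Extension.{u, v, w} H A) (k : compactOps H) : τ.q (τ.ι k) = 0 :=
  (τ.exact _).2 ⟨k, rfl⟩

/-- The algebra of an extension is the pullback of its Busby invariant along `π`. -/
theorem Extension.exists_rep_eq_q_eq (τ : Extension.{u, v, w} H A) {T : H →L[ℂ] H} {a : A}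
    (h : calkinMk H T = τ.busby a) : ∃ e : τ.E, τ.rep e = T ∧ τ.q e = a := by
  obtain ⟨e, rfl⟩ := τ.q_surjective a
  rw [τ.busby_q, calkinMk_eq_iff] at h
  -- Any lift of `a` has the right image in ℬ(H) up to a compact operator; adding this defect
  -- corrects `rep` and leaves `q` unchanged.
  refine ⟨e + τ.ι ⟨T - τ.rep e, h⟩, ?_, ?_⟩
  · rw [map_add, τ.rep_ι]
    exact add_sub_cancel _ _
  · rw [map_add, τ.q_ι, add_zero]

/-- An isomorphism of the algebras of two extensions which is compatible with the quotient maps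
and restricts to conjugation by a unitary `U` on the compact operators. -/
structure ExtensionIso (τ₁ τ₂ : Extension.{u, v, w} H A) where
  U : unitary (H →L[ℂ] H)
  hom : τ₁.E →⋆ₐ[ℂ] τ₂.E
  inv : τ₂.E →⋆ₐ[ℂ] τ₁.E
  inv_hom : ∀ e, inv (hom e) = e
  hom_inv : ∀ e, hom (inv e) = e
  q_hom : ∀ e, τ₂.q (hom e) = τ₁.q e
  hom_ι : ∀ k, hom (τ₁.ι k) = τ₂.ι (conjCompact U k)

/-- The hypothesis says that U rep(e) U* and q(e) are compatible, so they come from an element of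
the second algebra. That element is unique by `Extension.rep_q_injective`, so a pointwise choice is
automatically a *-homomorphism. -/
theorem exists_starAlgHom_of_busby_eq {τ₁ τ₂ : Extension.{u, v, w} H A} {U : H →L[ℂ] H}
    (hU : U ∈ unitary (H →L[ℂ] H))
    (h : ∀ a : A, τ₂.busby a = calkinMk H U * τ₁.busby a * calkinMk H (star U)) :
    ∃ f : τ₁.E →⋆ₐ[ℂ] τ₂.E, ∀ e, τ₂.rep (f e) = U * τ₁.rep e * star U ∧ τ₂.q (f e) = τ₁.q e := by
  have hex : ∀ e : τ₁.E, ∃ e' : τ₂.E, τ₂.rep e' = U * τ₁.rep e * star U ∧ τ₂.q e' = τ₁.q e :=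
    fun e => τ₂.exists_rep_eq_q_eq (by rw [h, τ₁.busby_q, map_mul, map_mul])
  choose f hf hf' using hex
  have hU1 : star U * U = 1 := Unitary.star_mul_self_of_mem hU
  have hU2 : U * star U = 1 := Unitary.mul_star_self_of_mem hU
  refine ⟨{
    toFun := f
    map_one' := τ₂.rep_q_injective ?_ ?_
    map_mul' := fun a b => τ₂.rep_q_injective ?_ ?_
    map_zero' := τ₂.rep_q_injective ?_ ?_
    map_add' := fun a b => τ₂.rep_q_injective ?_ ?_
    commutes' := fun c => τ₂.rep_q_injective ?_ ?_
    map_star' := fun a => τ₂.rep_q_injective ?_ ?_ }, fun e => ⟨hf e, hf' e⟩⟩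
  · rw [hf, map_one, map_one, mul_one, hU2]
  · rw [hf', map_one, map_one]
  · rw [map_mul, hf, hf, hf, map_mul]
    calc U * (τ₁.rep a * τ₁.rep b) * star U = U * τ₁.rep a * 1 * τ₁.rep b * star U := by
          noncomm_ring
      _ = _ := by rw [← hU1]; noncomm_ring
  · rw [map_mul, hf', hf', hf', map_mul]
  · rw [hf, map_zero, map_zero, mul_zero, zero_mul]
  · rw [hf', map_zero, map_zero]
  · rw [map_add, hf, hf, hf, map_add, mul_add, add_mul]
  · rw [map_add, hf', hf', hf', map_add]
  · rw [hf, AlgHomClass.commutes, AlgHomClass.commutes, ← Algebra.commutes, mul_assoc, hU2, mul_one]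
  · rw [hf', AlgHomClass.commutes, AlgHomClass.commutes]
  · rw [map_star, hf, hf, map_star, star_mul, star_mul, star_star, mul_assoc]
  · rw [map_star, hf', hf', map_star]

theorem StrongEquiv.nonempty_iso {τ₁ τ₂ : Extension.{u, v, w} H A} (h : StrongEquiv τ₁ τ₂) :
    Nonempty (ExtensionIso τ₁ τ₂) := by
  obtain ⟨U, hU, h⟩ := h
  have hU1 : star U * U = 1 := Unitary.star_mul_self_of_mem hU
  have hU2 : U * star U = 1 := Unitary.mul_star_self_of_mem hU
  have h1 : calkinMk H (star U) * calkinMk H U = 1 := by rw [← map_mul, hU1, map_one]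
  -- The same construction with U* in place of U provides the inverse.
  have h' : ∀ a : A,
      τ₁.busby a = calkinMk H (star U) * τ₂.busby a * calkinMk H (star (star U)) := fun a => by
    rw [h, star_star]
    calc τ₁.busby a = (calkinMk H (star U) * calkinMk H U) * τ₁.busby a *
          (calkinMk H (star U) * calkinMk H U) := by rw [h1, one_mul, mul_one]
      _ = _ := by simp only [mul_assoc]
  obtain ⟨f, hf⟩ := exists_starAlgHom_of_busby_eq hU h
  obtain ⟨g, hg⟩ := exists_starAlgHom_of_busby_eq (Unitary.star_mem hU) h'
  refine ⟨⟨⟨U, hU⟩, f, g, fun e => τ₁.rep_q_injective ?_ ?_, fun e => τ₂.rep_q_injective ?_ ?_,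
    fun e => (hf e).2, fun k => τ₂.rep_q_injective ?_ ?_⟩⟩
  · rw [(hg _).1, (hf _).1, star_star]
    calc star U * (U * τ₁.rep e * star U) * U
        = (star U * U) * τ₁.rep e * (star U * U) := by noncomm_ring
      _ = _ := by rw [hU1, one_mul, mul_one]
  · rw [(hg _).2, (hf _).2]
  · rw [(hf _).1, (hg _).1, star_star]
    calc U * (star U * τ₂.rep e * U) * star U
        = (U * star U) * τ₂.rep e * (U * star U) := by noncomm_ring
      _ = _ := by rw [hU2, one_mul, mul_one]
  · rw [(hf _).2, (hg _).2]
  · rw [(hf _).1, τ₁.rep_ι, τ₂.rep_ι, coe_conjCompact]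
  · rw [(hf _).2, τ₁.q_ι, τ₂.q_ι]

/-- Replace the isometry V by VU*: the range projection VV*, hence the K₀-class, is the same, while
the compression V*ρ(a)V becomes its conjugate by U. -/
theorem IsExtClass.conj {ρ : A →⋆ₐ[ℂ] (H →L[ℂ] H)} {β β' : A → Calkin H} {x : RedKHom1 ρ}
    (hx : IsExtClass ρ β x) {U : H →L[ℂ] H} (hU : U ∈ unitary (H →L[ℂ] H))
    (h : ∀ a, β' a = calkinMk H U * β a * calkinMk H (star U)) : IsExtClass ρ β' x := by
  obtain ⟨V, P, hP, hV, hPV, hβ, hx⟩ := hx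
  refine ⟨V * star U, P, hP, ?_, ?_, fun a => ?_, hx⟩
  · rw [star_mul, star_star]
    calc U * star V * (V * star U) = U * (star V * V) * star U := by noncomm_ring
      _ = 1 := by rw [hV, mul_one, Unitary.mul_star_self_of_mem hU]
  · rw [star_mul, star_star, hPV]
    calc V * star V = V * 1 * star V := by rw [mul_one]
      _ = V * star U * (U * star V) := by
        rw [← Unitary.star_mul_self_of_mem hU]; noncomm_ring
  · rw [h, hβ, ← map_mul, ← map_mul, star_mul, star_star]
    congr 1

end StrongEquivalence

/-! ## Transport of duality diagrams -/

section Transport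

variable {H : Type u} [NormedAddCommGroup H] [InnerProductSpace ℂ H] [CompleteSpace H]
  {A : Type v} [CStarAlgebra A] {A' : Type v'} [CStarAlgebra A']

theorem continuous_starAlgHom {B : Type*} {C : Type*} [CStarAlgebra B] [CStarAlgebra C]
    (f : B →⋆ₐ[ℂ] C) : Continuous f :=
  AddMonoidHomClass.continuous_of_bound f 1
    (by simpa only [one_mul] using NonUnitalStarAlgHom.norm_apply_le f)

/-! ### Naturality of `q_*`, `ι_*` and the index map under isomorphisms of extensions. -/

namespace ExtensionIso

variable {τ₁ τ₂ : Extension.{u, v, w} H A} (α : ExtensionIso τ₁ τ₂)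

/-- The isomorphism `K₀(E₁) ≃ K₀(E₂)`. -/
def K0Equiv : K0 τ₁.E ≃+ K0 τ₂.E :=
  K0.congr α.hom.toNonUnitalStarAlgHom α.inv.toNonUnitalStarAlgHom α.inv_hom α.hom_inv

/-- The isomorphism `K₁(E₁) ≃ K₁(E₂)`. -/
def K1Equiv : K1 τ₁.E ≃+ K1 τ₂.E :=
  K1.congr α.hom.toNonUnitalStarAlgHom (continuous_starAlgHom α.hom)
    α.inv.toNonUnitalStarAlgHom (continuous_starAlgHom α.inv) α.inv_hom α.hom_inv

theorem qK0_K0Equiv (x : K0 τ₁.E) : τ₂.qK0 (α.K0Equiv x) = τ₁.qK0 x :=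
  K0.map_map α.q_hom x

theorem qK1_K1Equiv (x : K1 τ₁.E) : τ₂.qK1 (α.K1Equiv x) = τ₁.qK1 x :=
  K1.map_map (hψ := continuous_starAlgHom α.hom) α.q_hom x

theorem K0Equiv_one : α.K0Equiv (K0.one τ₁.E) = K0.one τ₂.E :=
  K0.map_ofElem _ (IsStarProjection.one _) (IsStarProjection.one _) (map_one α.hom)

theorem starLift_eq {B : Type*} [CStarAlgebra B] (φ : compactOps H →⋆ₙₐ[ℂ] B)
    (x : Unitization ℂ (compactOps H)) :
    Unitization.starLift φ x = algebraMap ℂ B x.fst + φ x.snd := rfl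

/-- Both sides agree on scalars by unitality and on compact operators by `hom_ι`. This one square
yields naturality of both `ι_*` and the index map. -/
theorem starLift_conjCompact (x : Unitization ℂ (compactOps H)) :
    Unitization.starLift τ₂.ι (Unitization.starMap (conjCompact α.U) x) =
      α.hom (Unitization.starLift τ₁.ι x) := by
  rw [starLift_eq, starLift_eq, fst_starMap, snd_starMap,
    map_add, α.hom_ι, AlgHomClass.commutes]

theorem ιK0_conj (x : K0Compact H) : τ₂.ιK0 (K0Compact.conj α.U x) = α.K0Equiv (τ₁.ιK0 x) :=
  (K0.map_map (χ := (α.hom.comp (Unitization.starLift τ₁.ι)).toNonUnitalStarAlgHom)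
    α.starLift_conjCompact x.1).trans (K0.map_map (fun _ => rfl) x.1).symm

/-- Push the witnesses forward: since the isomorphism lies over the identity of `A`, the image of
`w` still lifts u ⊕ u*, and Ad(U) applied to `P` is the projection belonging to the new lift. -/
theorem isIndexMap_conj {y : K1 A} {z : K0Compact H} (h : τ₁.IsIndexMap y z) :
    τ₂.IsIndexMap y (K0Compact.conj α.U z) := by
  obtain ⟨n, u, w, P, hP, hw, hPw, hy, hz⟩ := h
  let φ : Unitization ℂ (compactOps H) →⋆ₙₐ[ℂ] Unitization ℂ (compactOps H) :=
    (Unitization.starMap (conjCompact α.U)).toNonUnitalStarAlgHom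
  have hone : (1 : Matrix (Fin (n + n)) (Fin (n + n)) τ₁.E).map α.hom = 1 := by
    ext i j
    simp [Matrix.one_apply, apply_ite α.hom]
  -- The correction term in `mapMat` vanishes because `α.hom` is unital.
  have hcoe : (UnitaryMat.mapMat α.hom.toNonUnitalStarAlgHom w :
      Matrix (Fin (n + n)) (Fin (n + n)) τ₂.E) = (w : Matrix (Fin (n + n)) (Fin (n + n)) τ₁.E).map α.hom := by
    change (w : Matrix (Fin (n + n)) (Fin (n + n)) τ₁.E).map α.hom +
      (1 - (1 : Matrix (Fin (n + n)) (Fin (n + n)) τ₁.E).map α.hom) = _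
    rw [hone, sub_self, add_zero]
  have hstar : star ((w : Matrix (Fin (n + n)) (Fin (n + n)) τ₁.E).map α.hom) =
      (star (w : Matrix (Fin (n + n)) (Fin (n + n)) τ₁.E)).map α.hom := by
    rw [star_eq_conjTranspose, star_eq_conjTranspose,
      conjTranspose_map α.hom (fun x => map_star α.hom x)]
  have hdsum : (dsum (1 : Matrix (Fin n) (Fin n) τ₁.E) (0 : Matrix (Fin n) (Fin n) τ₁.E)).map
      α.hom = dsum 1 0 := by
    rw [map_dsum _ _ _ (map_zero α.hom)]
    congr 1
    · ext i j
      simp [Matrix.one_apply, apply_ite α.hom]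
    · ext i j
      simp
  refine ⟨n, u, UnitaryMat.mapMat α.hom.toNonUnitalStarAlgHom w, P.map φ,
    (Proj.map φ ⟨n + n, P, hP⟩).isProj, ?_, ?_, hy, ?_⟩
  · rw [hcoe, ← hw]
    ext i j
    exact α.q_hom _
  · rw [hcoe, hstar, ← hdsum, ← Matrix.map_mul, ← Matrix.map_mul, ← hPw]
    ext i j
    exact α.starLift_conjCompact _
  · rw [K0Compact.coe_conj, hz, map_sub, K0.map_mk, K0.map_mk]
    congr 2
    -- What remains is that the extension of Ad(U) to the unitization, being unital, fixes 1_n ⊕ 0.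
    simp only [Proj.map, Proj.half]
    congr 1
    rw [map_dsum _ _ _ (map_zero _)]
    congr 1
    · ext1 i j
      rw [Matrix.map_apply, Matrix.one_apply]
      split_ifs
      · exact map_one (Unitization.starMap (conjCompact α.U))
      · exact map_zero (Unitization.starMap (conjCompact α.U))
    · ext1 i j
      exact map_zero (Unitization.starMap (conjCompact α.U))

end ExtensionIso

/-! ### Moving diagrams and their normalizations along strong equivalences. -/

namespace DualityDiagram

variable {ρ : A →⋆ₐ[ℂ] (H →L[ℂ] H)} {τ₁' τ₂' : Extension.{u, v', w'} H A'}

/-- Composition of a duality diagram with an isomorphism of extensions. -/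
def transport (D : DualityDiagram ρ τ₁') (α : ExtensionIso τ₁' τ₂') : DualityDiagram ρ τ₂' where
  redΦ0 := D.redΦ0.trans α.K1Equiv
  Φ0 := D.Φ0
  -- The twist by Ad(U)_* makes the squares with ∂ and `ι_*` commute; whether it acts trivially on
  -- K₀(𝒦(H)) need not be decided.
  Φscalar := D.Φscalar.trans (K0Compact.conj α.U)
  redΦ1 := D.redΦ1.trans α.K0Equiv
  Φ1 := D.Φ1
  comm_j0 x := (α.qK1_K1Equiv _).trans (D.comm_j0 x)
  comm_index x := α.isIndexMap_conj (D.comm_index x)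
  comm_iota x := by
    obtain ⟨y, hy, h⟩ := D.comm_iota x
    exact ⟨y, hy, (α.ιK0_conj _).trans (congrArg α.K0Equiv h)⟩
  comm_j1 x := (α.qK0_K0Equiv _).trans (D.comm_j1 x)

theorem IsStrong.transport {D : DualityDiagram ρ τ₁'} {τ : Extension.{u, v, w} H A}
    (h : D.IsStrong τ) (α : ExtensionIso τ₁' τ₂') : (D.transport α).IsStrong τ where
  scalar_eq_id x n hx e he hrk := by
    -- The normalization of `D` holds for every rank one projection, in particular for U*eU, which
    -- Ad(U) carries back to `e`.
    have he' : IsStarProjection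
        (Unitization.inr (conjCompact (star α.U) e) : Unitization ℂ (compactOps H)) := by
      have h1 := he.map (Unitization.starMap (conjCompact (star α.U)))
      rwa [Unitization.starMap_inr] at h1
    have h1 := h.scalar_eq_id x n hx (conjCompact (star α.U) e) he'
      ((finrank_range_conjCompact _ e).trans hrk)
    change K0.map _ (D.Φscalar x : K0 (Unitization ℂ (compactOps H))) = _
    rw [h1, map_zsmul]
    congr 1
    refine K0.map_ofElem _ _ _ ?_
    change Unitization.starMap (conjCompact α.U) _ = _
    rw [Unitization.starMap_inr, conjCompact_apply_star]
  map_class := by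
    obtain ⟨x, hx, hx'⟩ := h.map_class
    refine ⟨x, hx, ?_⟩
    change α.K0Equiv (D.redΦ1 x) = _
    rw [hx', map_neg, α.K0Equiv_one]

/-- Only the condition on the class involves the extension of `A`, and the same element of K̃¹(A)
represents both classes. -/
theorem IsStrong.of_strongEquiv {D : DualityDiagram ρ τ₁'} {τ₁ τ₂ : Extension.{u, v, w} H A}
    (h : D.IsStrong τ₁) (hτ : StrongEquiv τ₁ τ₂) : D.IsStrong τ₂ where
  scalar_eq_id := h.scalar_eq_id
  map_class := by
    obtain ⟨x, hx, hx'⟩ := h.map_class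
    obtain ⟨U, hU, hτ⟩ := hτ
    exact ⟨x, hx.conj hU hτ, hx'⟩

end DualityDiagram

variable {ρ : A →⋆ₐ[ℂ] (H →L[ℂ] H)} {ρ' : A' →⋆ₐ[ℂ] (H →L[ℂ] H)}
  {τ₁ τ₂ : Extension.{u, v, w} H A} {τ₁' τ₂' : Extension.{u, v', w'} H A'}

/-- Each diagram joins the K-homology of one algebra to an extension of the other, so `D` moves
along the isomorphism of the primed extensions and `D'` along the unprimed one. -/
theorem IsDualityPair.of_strongEquiv (hp : IsDualityPair ρ ρ' τ₁ τ₁') (h : StrongEquiv τ₁ τ₂)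
    (h' : StrongEquiv τ₁' τ₂') : IsDualityPair ρ ρ' τ₂ τ₂' := by
  obtain ⟨⟨D⟩, ⟨D'⟩⟩ := hp
  obtain ⟨α⟩ := h.nonempty_iso
  obtain ⟨α'⟩ := h'.nonempty_iso
  exact ⟨⟨D.transport α'⟩, ⟨D'.transport α⟩⟩

/-- Both extensions now enter each diagram: one as the target, changed by transport, the other
through its class, changed by `IsStrong.of_strongEquiv`. -/
theorem IsStrongDualityPair.of_strongEquiv (hp : IsStrongDualityPair ρ ρ' τ₁ τ₁')
    (h : StrongEquiv τ₁ τ₂) (h' : StrongEquiv τ₁' τ₂') : IsStrongDualityPair ρ ρ' τ₂ τ₂' := by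
  obtain ⟨⟨D, hD⟩, ⟨D', hD'⟩⟩ := hp
  obtain ⟨α⟩ := h.nonempty_iso
  obtain ⟨α'⟩ := h'.nonempty_iso
  exact ⟨⟨D.transport α', (hD.transport α').of_strongEquiv h⟩,
    ⟨D'.transport α, (hD'.transport α).of_strongEquiv h'⟩⟩

end Transport

end

end KDuality

theorem mainTheorem8
    {H : Type*} [NormedAddCommGroup H] [InnerProductSpace ℂ H] [CompleteSpace H]
    [TopologicalSpace.SeparableSpace H] (hH : ¬ FiniteDimensional ℂ H)
    {A A' : Type*} [CStarAlgebra A] [TopologicalSpace.SeparableSpace A]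
    [CStarAlgebra A'] [TopologicalSpace.SeparableSpace A']
    (hA : KDuality.IsNuclear A) (hA' : KDuality.IsNuclear A')
    (ρ : A →⋆ₐ[ℂ] (H →L[ℂ] H)) (hρ : KDuality.IsAmple ρ)
    (ρ' : A' →⋆ₐ[ℂ] (H →L[ℂ] H)) (hρ' : KDuality.IsAmple ρ')
    (τ₁ τ₂ : KDuality.Extension H A) (τ₁' τ₂' : KDuality.Extension H A')
    (h : KDuality.StrongEquiv τ₁ τ₂) (h' : KDuality.StrongEquiv τ₁' τ₂') :
    (KDuality.IsDualityPair ρ ρ' τ₁ τ₁' ↔ KDuality.IsDualityPair ρ ρ' τ₂ τ₂') ∧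
      (KDuality.IsStrongDualityPair ρ ρ' τ₁ τ₁' ↔
        KDuality.IsStrongDualityPair ρ ρ' τ₂ τ₂') := by
  exact ⟨⟨fun hp => hp.of_strongEquiv h h', fun hp => hp.of_strongEquiv h.symm h'.symm⟩,
    ⟨fun hp => hp.of_strongEquiv h h', fun hp => hp.of_strongEquiv h.symm h'.symm⟩⟩
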